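/- Let $K>1$, let $\mu=\mu_1\times\dots\times\mu_K$ be a product of probability measures on measurable spaces $S_1,\dots,S_K$, and let $S=S_1\times\dots\times S_K$. Let $\gamma\neq 0$ be a finite (unsigned) measure on $S$ that is absolutely continuous with respect to $\mu$, with density $w=d\gamma/d\mu$, and put $\pi=\gamma/\gamma(S)$, $w^\pi=w/\gamma(S)$. We write $\nu(\psi)=\int\psi\,d\nu$. Let $X^n=(X^n_1,\dots,X^n_K)$, $n\ge 1$, be i.i.d. with law $\mu$, and for $\psi:S\to\mathbb R$ put $$\mu^N(\psi)=\frac1N\sum_{n=1}^N\psi(X^n),\qquad \mu^N_\times(\psi)=\frac1{N^K}\sum_{(n_1,\dots,n_K)\in\{1,\dots,N\}^K}\psi(X^{n_1}_1,\dots,X^{n_K}_K).$$ Let $\pi^N(\varphi)=\mu^N(w\varphi)/\mu^N(w)$ be the standard self-normalized importance sampling estimator and $\pi^N_\times(\varphi)=\mu^N_\times(w\varphi)/\mu^N_\times(w)$ its product-form version. For $\psi\in L^2_\mu$ put $$\sigma^2(\psi)=\mu\big([\psi-\mu(\psi)]^2\big),\qquad \sigma^2_\times(\psi)=\sum_{k=1}^K\mu_k\big([\mu_{\{k\}^c}(\psi)-\mu(\psi)]^2\big),$$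 where $\mu_{\{k\}^c}(\psi)$ is the function on $S_k$ obtained by integrating out all arguments of $\psi$ other than the $k$-th one with respect to $\prod_{j\ne k}\mu_j$. Let $\varphi:S\to\mathbb R$ be measurable with $w\varphi\in L^2_\mu$. Then $\pi^N_\times(\varphi)$ is strongly consistent: $\pi^N_\times(\varphi)\to\pi(\varphi)$ almost surely as $N\to\infty$. If moreover $w^\pi[\varphi-\pi(\varphi)]\in L^2_\mu$ (for instance, if $w\in L^2_\mu$), then both estimators are asymptotically normal: as $N\to\infty$, $$N^{1/2}[\pi^N_\times(\varphi)-\pi(\varphi)]\Rightarrow\mathcal N\big(0,\sigma^2_\times(w^\pi[\varphi-\pi(\varphi)])\big),\qquad N^{1/2}[\pi^N(\varphi)-\pi(\varphi)]\Rightarrow\mathcal N\big(0,\sigma^2(w^\pi[\varphi-\pi(\varphi)])\big)$$ in distribution, and the asymptotic variances satisfy $$\sigma^2_\times(w^\pi[\varphi-\pi(\varphi)])\le\sigma^2(w^\pi[\varphi-\pi(\varphi)]).$$ -/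

import Mathlib

open MeasureTheory ProbabilityTheory Filter Topology

namespace ProductFormIS

noncomputable section

variable {K : ℕ} {S : Fin K → Type*}

/-- The conventional Monte Carlo estimator `μ^N(φ) = N⁻¹ ∑_{n} φ(X^n)`
computed from the first `N` tuples of the sequence `x`. -/
def stdEst (x : ℕ → ∀ k, S k) (N : ℕ) (φ : (∀ k, S k) → ℝ) : ℝ :=
  (N : ℝ)⁻¹ * ∑ n : Fin N, φ (x n)

/-- The product-form estimator
`μ_×^N(φ) = N^{-K} ∑_{n ∈ [N]^K} φ(X^{n_1}_1, …, X^{n_K}_K)`. -/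
def prodEst (x : ℕ → ∀ k, S k) (N : ℕ) (φ : (∀ k, S k) → ℝ) : ℝ :=
  ((N : ℝ) ^ K)⁻¹ * ∑ n : Fin K → Fin N, φ (fun k ↦ x (n k) k)

/-- The importance sampling estimator `γ^N(φ) = μ^N(w φ)`. -/
def isEst (w : (∀ k, S k) → ℝ) (x : ℕ → ∀ k, S k) (N : ℕ) (φ : (∀ k, S k) → ℝ) : ℝ :=
  stdEst x N (fun y ↦ w y * φ y)

/-- The product-form importance sampling estimator `γ_×^N(φ) = μ_×^N(w φ)`. -/
def prodISEst (w : (∀ k, S k) → ℝ) (x : ℕ → ∀ k, S k) (N : ℕ) (φ : (∀ k, S k) → ℝ) : ℝ :=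
  prodEst x N (fun y ↦ w y * φ y)

/-- The self-normalized importance sampling estimator `π^N(φ) = γ^N(φ) / γ^N(S)`. -/
def snisEst (w : (∀ k, S k) → ℝ) (x : ℕ → ∀ k, S k) (N : ℕ) (φ : (∀ k, S k) → ℝ) : ℝ :=
  isEst w x N φ / isEst w x N (fun _ ↦ 1)

/-- The self-normalized product-form importance sampling estimator
`π_×^N(φ) = γ_×^N(φ) / γ_×^N(S)`. -/
def prodSnisEst (w : (∀ k, S k) → ℝ) (x : ℕ → ∀ k, S k) (N : ℕ) (φ : (∀ k, S k) → ℝ) : ℝ :=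
  prodISEst w x N φ / prodISEst w x N (fun _ ↦ 1)

variable [∀ k, MeasurableSpace (S k)]

/-- The function `μ_{{k}ᶜ}(φ)` on `S k`: all arguments of `φ` but the `k`-th are integrated out.
The integral runs over the full product, but its integrand does not depend on `y k`, and
the `k`-th factor is a probability measure wherever this is used. -/
def marginalMean (μ : ∀ k, Measure (S k)) (φ : (∀ k, S k) → ℝ) (k : Fin K) (a : S k) : ℝ :=
  ∫ y, φ (Function.update y k a) ∂(Measure.pi μ)

/-- `σ²(φ) = μ([φ - μ(φ)]²)`, where `μ` is the product of the `μ k`. -/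
def stdVar (μ : ∀ k, Measure (S k)) (φ : (∀ k, S k) → ℝ) : ℝ :=
  ∫ y, (φ y - ∫ z, φ z ∂(Measure.pi μ)) ^ 2 ∂(Measure.pi μ)

/-- `σ_×²(φ) = ∑_k μ_k([μ_{{k}ᶜ}(φ) - μ(φ)]²)`, where `μ` is the product of the `μ k`. -/
def prodVar (μ : ∀ k, Measure (S k)) (φ : (∀ k, S k) → ℝ) : ℝ :=
  ∑ k, ∫ a, (marginalMean μ φ k a - ∫ z, φ z ∂(Measure.pi μ)) ^ 2 ∂(μ k)

/-- The normalized target `π = γ / γ(S)`. -/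
def normalized {α : Type*} [MeasurableSpace α] (γ : Measure α) : Measure α :=
  (γ Set.univ)⁻¹ • γ

/-- The function `w^π [φ - π(φ)]`, where `w^π = w / γ(S)` and `π = γ / γ(S)`. -/
def centredWeighted (γ : Measure (∀ k, S k)) (w φ : (∀ k, S k) → ℝ) (y : ∀ k, S k) : ℝ :=
  w y / γ.real Set.univ * (φ y - ∫ z, φ z ∂(normalized γ))

end

end ProductFormIS

/-! The entries of an i.i.d. sample of a product measure are all independent, so permuting the
samples separately in each coordinate preserves the law (`measurePreserving_permute`), and the
product-form estimator is invariant under such permutations.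

Consistency. The weight is only known to be integrable, so a strong law in L¹ is needed for the
denominator. Symmetry makes the product-form estimators behave like a reverse martingale: stopping
at the last exceedance gives a maximal inequality (`mul_measure_exists_le`) that controls all N ≥ M
by the L¹ error at M. That error tends to 0 by a variance bound for simple functions and an L¹
contraction (`tendsto_integral_abs_prodEst`).

Asymptotic normality. A centred square-integrable function is the sum of its one-coordinate marginal
means plus a remainder whose marginal means vanish (the start of the Hoeffding decomposition). On
additive functions both estimators coincide (`prodEst_sum_eval`), so the classical central limit
theorem applies. For the remainder, only pairs of tuples sharing at least two coordinates correlate,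
so its second moment is O(N⁻²) (`integral_prodEst_sq_le`), negligible after scaling by √N. The two
parts are orthogonal, and Pythagoras gives the variance inequality. Self-normalization is then
Slutsky's theorem, through an exact identity for the error. -/

namespace ProductFormIS

/-! ### The sample law and its coordinatewise exchangeability -/

section Sampling

variable {K : ℕ} {S : Fin K → Type*}

/-- The tuple whose `k`-th entry is the `k`-th entry of the `n k`-th sample. -/
def pick (n : Fin K → ℕ) (x : ℕ → ∀ k, S k) : ∀ k, S k := fun k ↦ x (n k) k

/-- Reindex the samples by `σ k` in the `k`-th coordinate. -/
def permute (σ : Fin K → Equiv.Perm ℕ) (x : ℕ → ∀ k, S k) : ℕ → ∀ k, S k :=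
  fun n k ↦ x (σ k n) k

/-- The tuple that agrees with `p.1` on `A` and with `p.2` off `A`. -/
def mix (A : Finset (Fin K)) (p : (∀ k, S k) × (∀ k, S k)) : ∀ k, S k :=
  fun k ↦ if k ∈ A then p.1 k else p.2 k

lemma mix_empty (p : (∀ k, S k) × (∀ k, S k)) : mix ∅ p = p.2 := by
  ext; simp [mix]

lemma mix_singleton (k : Fin K) (p : (∀ k, S k) × (∀ k, S k)) :
    mix {k} p = Function.update p.2 k (p.1 k) := by
  ext j
  by_cases h : j = k
  · subst h; simp [mix]
  · simp [mix, h]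

lemma pick_eq_permute_zero (n : Fin K → ℕ) (x : ℕ → ∀ k, S k) :
    pick n x = permute (fun k ↦ Equiv.swap 0 (n k)) x 0 := by
  ext k; simp [pick, permute]

variable [∀ k, MeasurableSpace (S k)]

@[fun_prop]
lemma measurable_pick (n : Fin K → ℕ) : Measurable (pick (S := S) n) := by
  unfold pick; fun_prop

@[fun_prop]
lemma measurable_permute (σ : Fin K → Equiv.Perm ℕ) : Measurable (permute (S := S) σ) := by
  unfold permute; fun_prop

@[fun_prop]
lemma measurable_mix (A : Finset (Fin K)) : Measurable (mix (S := S) A) := by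
  unfold mix
  refine measurable_pi_lambda _ fun k ↦ ?_
  by_cases h : k ∈ A <;> simp only [h, if_true, if_false] <;> fun_prop

/-- The law of an i.i.d. sequence of samples from the product of the `μ k`. -/
noncomputable def sampleLaw (μ : ∀ k, Measure (S k)) [∀ k, IsProbabilityMeasure (μ k)] :
    Measure (ℕ → ∀ k, S k) :=
  Measure.infinitePi fun _ : ℕ ↦ Measure.pi μ

variable (μ : ∀ k, Measure (S k)) [∀ k, IsProbabilityMeasure (μ k)]

instance : IsProbabilityMeasure (sampleLaw μ) := by unfold sampleLaw; infer_instance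

lemma measurePreserving_sample (n : ℕ) :
    MeasurePreserving (fun x : ℕ → ∀ k, S k ↦ x n) (sampleLaw μ) (Measure.pi μ) :=
  measurePreserving_eval_infinitePi _ n

lemma iIndepFun_sample : iIndepFun (fun (n : ℕ) (x : ℕ → ∀ k, S k) ↦ x n) (sampleLaw μ) :=
  iIndepFun_infinitePi (P := fun _ : ℕ ↦ Measure.pi μ) (X := fun _ y ↦ y) fun _ ↦ measurable_id

lemma iIndepFun_sample_entries :
    iIndepFun (fun (p : (_ : ℕ) × Fin K) (x : ℕ → ∀ k, S k) ↦ x p.1 p.2) (sampleLaw μ) := by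
  refine iIndepFun_uncurry (X := fun (n : ℕ) (k : Fin K) (x : ℕ → ∀ k, S k) ↦ x n k)
    (fun n k ↦ by fun_prop) (iIndepFun_sample μ) fun n ↦ ?_
  have hm : ∀ k, AEMeasurable (fun x : ℕ → ∀ k, S k ↦ x n k) (sampleLaw μ) := fun k ↦
    ((measurable_pi_apply k).comp (measurable_pi_apply n)).aemeasurable
  rw [iIndepFun_iff_map_fun_eq_pi_map hm]
  have h : ∀ k, (sampleLaw μ).map (fun x ↦ x n k) = μ k := fun k ↦
    ((measurePreserving_eval μ k).comp (measurePreserving_sample μ n)).map_eq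
  simp_rw [h]
  exact (measurePreserving_sample μ n).map_eq

/-- All entries are independent and the law of an entry depends only on its coordinate. The
reindexing (n, k) ↦ (σ k n, k) is injective and keeps the coordinate, so the joint law is unchanged.
-/
lemma measurePreserving_permute (σ : Fin K → Equiv.Perm ℕ) :
    MeasurePreserving (permute σ) (sampleLaw μ) (sampleLaw μ) := by
  refine ⟨measurable_permute σ, ?_⟩
  let f : (_ : ℕ) × Fin K → (_ : ℕ) × Fin K := fun p ↦ ⟨σ p.2 p.1, p.2⟩
  have hf : Function.Injective f := by
    rintro ⟨n, k⟩ ⟨n', k'⟩ h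
    simp only [f, Sigma.mk.injEq] at h
    obtain ⟨h1, h2⟩ := h
    obtain rfl := eq_of_heq h2
    simp [(σ k).injective h1]
  have hl : ∀ n k, (sampleLaw μ).map (fun x ↦ x n k) = μ k := fun n k ↦
    ((measurePreserving_eval μ k).comp (measurePreserving_sample μ n)).map_eq
  have h1 := (iIndepFun_sample_entries μ).map_fun_eq_infinitePi_map (fun p ↦ by fun_prop)
  have h2 := ((iIndepFun_sample_entries μ).precomp hf).map_fun_eq_infinitePi_map
    (fun p ↦ by fun_prop)
  have h3 : (sampleLaw μ).map (fun x (p : (_ : ℕ) × Fin K) ↦ x (σ p.2 p.1) p.2) =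
      (sampleLaw μ).map (fun x (p : (_ : ℕ) × Fin K) ↦ x p.1 p.2) := by
    rw [h1]
    refine h2.trans ?_
    congr 1
    funext p
    exact (hl _ _).trans (hl _ _).symm
  let c : (∀ p : (_ : ℕ) × Fin K, S p.2) → ℕ → ∀ k, S k := fun z n k ↦ z ⟨n, k⟩
  have hc : Measurable c := by fun_prop
  have h4 := congrArg (Measure.map c) h3
  rw [Measure.map_map hc (by fun_prop), Measure.map_map hc (by fun_prop)] at h4
  exact h4.trans Measure.map_id

lemma measurePreserving_pick (n : Fin K → ℕ) :
    MeasurePreserving (pick n) (sampleLaw μ) (Measure.pi μ) := by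
  have : pick (S := S) n = (fun x ↦ x 0) ∘ permute (fun k ↦ Equiv.swap 0 (n k)) := by
    funext x; exact pick_eq_permute_zero n x
  rw [this]
  exact (measurePreserving_sample μ 0).comp (measurePreserving_permute μ _)

lemma measurePreserving_sample_pair :
    MeasurePreserving (fun x : ℕ → ∀ k, S k ↦ (x 0, x 1)) (sampleLaw μ)
      ((Measure.pi μ).prod (Measure.pi μ)) :=
  ⟨by fun_prop, Measure.infinitePi_map_eval_prod (P := fun _ : ℕ ↦ Measure.pi μ) zero_ne_one⟩

lemma measurePreserving_mix (A : Finset (Fin K)) :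
    MeasurePreserving (mix A) ((Measure.pi μ).prod (Measure.pi μ)) (Measure.pi μ) := by
  refine ⟨measurable_mix A, ?_⟩
  rw [← (measurePreserving_sample_pair μ).map_eq, Measure.map_map (by fun_prop) (by fun_prop),
    ← (measurePreserving_pick μ fun k ↦ if k ∈ A then 0 else 1).map_eq]
  congr 1
  ext x k
  by_cases h : k ∈ A <;> simp [mix, pick, h]

/-- This is `mix {k}` with the first copy reduced to its k-th coordinate. It is the form of Fubini
behind every computation with marginal means below. -/
lemma measurePreserving_update (k : Fin K) :
    MeasurePreserving (fun p : S k × (∀ k, S k) ↦ Function.update p.2 k p.1)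
      ((μ k).prod (Measure.pi μ)) (Measure.pi μ) := by
  have hm : Measurable (fun p : S k × (∀ k, S k) ↦ Function.update p.2 k p.1) := by
    refine measurable_pi_lambda _ fun j ↦ ?_
    by_cases h : j = k
    · subst h; simpa using measurable_fst
    · simp only [Function.update_of_ne h]; fun_prop
  refine ⟨hm, ?_⟩
  have h := (measurePreserving_eval μ k).prod (MeasurePreserving.id (Measure.pi μ))
  rw [← h.map_eq, Measure.map_map hm h.measurable]
  convert (measurePreserving_mix μ {k}).map_eq using 2
  ext p : 1
  rw [mix_singleton]
  rfl

/-- The joint law of two picks depends only on the coordinates in which they agree. -/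
lemma measurePreserving_pick_pair (n n' : Fin K → ℕ) :
    (sampleLaw μ).map (fun x ↦ (pick n x, pick n' x)) =
      ((Measure.pi μ).prod (Measure.pi μ)).map
        (fun p ↦ (p.1, mix {k | n k = n' k} p)) := by
  have hσ : ∀ k, ∃ σ : Equiv.Perm ℕ, σ 0 = n k ∧ (n k ≠ n' k → σ 1 = n' k) := by
    intro k
    by_cases h : n k = n' k
    · exact ⟨Equiv.swap 0 (n k), by simp, fun h' ↦ (h' h).elim⟩
    -- The inner swap sends 1 to the preimage of `n' k` under the outer one; it fixes 0 because that
    -- preimage is nonzero.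
    · refine ⟨Equiv.swap 0 (n k) * Equiv.swap 1 (Equiv.swap 0 (n k) (n' k)), ?_, ?_⟩
      · have : Equiv.swap 0 (n k) (n' k) ≠ 0 := by
          intro h0
          apply h
          rw [Equiv.swap_apply_eq_iff] at h0
          simpa using h0.symm
        rw [Equiv.Perm.mul_apply, Equiv.swap_apply_of_ne_of_ne zero_ne_one this.symm]
        simp
      · intro _
        simp [Equiv.Perm.mul_apply]
  choose σ hσ0 hσ1 using hσ
  have hg : Measurable (fun p : (∀ k, S k) × (∀ k, S k) ↦ (p.1, mix {k | n k = n' k} p)) := by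
    fun_prop
  have h := (measurePreserving_sample_pair μ).comp (measurePreserving_permute μ σ)
  rw [← h.map_eq, Measure.map_map hg h.measurable]
  congr 1
  ext x k
  · simp [pick, permute, hσ0]
  · by_cases hk : n k = n' k
    · simp [pick, permute, mix, hσ0, hk]
    · simp [pick, permute, mix, hσ1 k hk, hk]

end Sampling

/-! ### Maximal inequality and almost sure convergence -/

section StrongLaw

variable {K : ℕ} {S : Fin K → Type*}

lemma prodEst_eq_sum_pick (x : ℕ → ∀ k, S k) (N : ℕ) (φ : (∀ k, S k) → ℝ) :
    prodEst x N φ = ((N : ℝ) ^ K)⁻¹ * ∑ n : Fin K → Fin N, φ (pick (fun k ↦ n k) x) := rfl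

/-- The product-form estimator is a symmetric function of the first `M` samples,
separately in each coordinate. -/
lemma prodEst_permute_swap {M : ℕ} (m : Fin K → ℕ) (hm : ∀ k, m k < M) (x : ℕ → ∀ k, S k)
    (φ : (∀ k, S k) → ℝ) :
    prodEst (permute (fun k ↦ Equiv.swap 0 (m k)) x) M φ = prodEst x M φ := by
  unfold prodEst
  congr 1
  have h0 : ∀ k : Fin K, 0 < M := fun k ↦ (Nat.zero_le _).trans_lt (hm k)
  refine Fintype.sum_equiv
    (Equiv.piCongrRight fun k ↦ Equiv.swap (⟨0, h0 k⟩ : Fin M) ⟨m k, hm k⟩) _ _ fun n ↦ ?_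
  congr 1
  ext k
  simp only [permute, Equiv.piCongrRight_apply, Pi.map_apply]
  congr 1
  simp only [Equiv.swap_apply_def, Fin.ext_iff]
  split_ifs <;> rfl

lemma prodEst_add (x : ℕ → ∀ k, S k) (N : ℕ) (φ ψ : (∀ k, S k) → ℝ) :
    prodEst x N (fun y ↦ φ y + ψ y) = prodEst x N φ + prodEst x N ψ := by
  simp [prodEst, Finset.sum_add_distrib, mul_add]

lemma prodEst_const_mul (x : ℕ → ∀ k, S k) (N : ℕ) (c : ℝ) (φ : (∀ k, S k) → ℝ) :
    prodEst x N (fun y ↦ c * φ y) = c * prodEst x N φ := by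
  simp only [prodEst, ← Finset.mul_sum]; ring

lemma prodEst_const (x : ℕ → ∀ k, S k) {N : ℕ} (hN : N ≠ 0) (c : ℝ) :
    prodEst x N (fun _ ↦ c) = c := by
  simp [prodEst, hN]

lemma abs_prodEst_le (x : ℕ → ∀ k, S k) (N : ℕ) (φ : (∀ k, S k) → ℝ) :
    |prodEst x N φ| ≤ prodEst x N (fun y ↦ |φ y|) := by
  unfold prodEst
  rw [abs_mul, abs_of_nonneg (by positivity : (0 : ℝ) ≤ ((N : ℝ) ^ K)⁻¹)]
  gcongr
  exact Finset.abs_sum_le_sum_abs _ _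

variable [∀ k, MeasurableSpace (S k)]

lemma measurable_prodEst (N : ℕ) {φ : (∀ k, S k) → ℝ} (hφ : Measurable φ) :
    Measurable (fun x ↦ prodEst x N φ) := by
  simp_rw [prodEst_eq_sum_pick]; fun_prop

variable (μ : ∀ k, Measure (S k)) [∀ k, IsProbabilityMeasure (μ k)]

lemma integrable_prodEst (N : ℕ) {φ : (∀ k, S k) → ℝ} (hi : Integrable φ (Measure.pi μ)) :
    Integrable (fun x ↦ prodEst x N φ) (sampleLaw μ) := by
  simp_rw [prodEst_eq_sum_pick]
  refine Integrable.const_mul (integrable_finsetSum _ fun n _ ↦ ?_) _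
  exact (measurePreserving_pick μ _).integrable_comp_of_integrable hi

/-- On an event that is symmetric in the first `N` samples, separately in each coordinate,
the product-form estimator has the same mean as a single evaluation. -/
lemma setIntegral_prodEst {N : ℕ} (hN : N ≠ 0) {φ : (∀ k, S k) → ℝ} (hφ : Measurable φ)
    (hi : Integrable φ (Measure.pi μ)) {D : Set (ℕ → ∀ k, S k)} (hD : MeasurableSet D)
    (hsymm : ∀ m : Fin K → ℕ, (∀ k, m k < N) →
      permute (fun k ↦ Equiv.swap 0 (m k)) ⁻¹' D = D) :
    ∫ x in D, prodEst x N φ ∂(sampleLaw μ) = ∫ x in D, φ (x 0) ∂(sampleLaw μ) := by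
  simp_rw [prodEst_eq_sum_pick]
  have hin : ∀ n : Fin K → Fin N,
      Integrable (fun x ↦ φ (pick (fun k ↦ n k) x)) ((sampleLaw μ).restrict D) :=
    fun n ↦ ((measurePreserving_pick μ _).integrable_comp_of_integrable hi).integrableOn
  rw [integral_const_mul, integral_finsetSum _ fun n _ ↦ hin n]
  have h : ∀ n : Fin K → Fin N, ∫ x in D, φ (pick (fun k ↦ n k) x) ∂(sampleLaw μ) =
      ∫ x in D, φ (x 0) ∂(sampleLaw μ) := by
    intro n
    -- Every summand is the evaluation at sample 0 after a law-preserving permutation that fixes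
    -- `D`, so all N^K summands have the same integral.
    have hT := measurePreserving_permute μ fun k ↦ Equiv.swap 0 (n k : ℕ)
    conv_rhs => rw [← hT.map_eq]
    have hφ0 : Measurable fun x : ℕ → ∀ k, S k ↦ φ (x 0) := hφ.comp (measurable_pi_apply 0)
    rw [setIntegral_map hD hφ0.aestronglyMeasurable hT.measurable.aemeasurable,
      hsymm _ fun k ↦ (n k).isLt]
    simp_rw [pick_eq_permute_zero]
  simp only [h, Finset.sum_const, Finset.card_univ, Fintype.card_fun, Fintype.card_fin]
  have : (N : ℝ) ≠ 0 := by exact_mod_cast hN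
  rw [nsmul_eq_mul]
  push_cast
  field_simp

/-- A maximal inequality for the product-form estimator, obtained by stopping at the last time
that the level is exceeded. -/
lemma mul_measure_exists_le {M : ℕ} (hM : M ≠ 0) (L : ℕ) {φ : (∀ k, S k) → ℝ} (hφ : Measurable φ)
    (hi : Integrable φ (Measure.pi μ)) (c ε : ℝ) :
    ε * (sampleLaw μ).real {x | ∃ N ∈ Finset.Icc M L, ε ≤ prodEst x N φ - c} ≤
      ∫ x, |prodEst x M φ - c| ∂(sampleLaw μ) := by
  let Q := sampleLaw μ
  -- `D N` says that N is the last exceedance up to L. It involves only estimators of index at least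
  -- N, hence is symmetric in the first N samples.
  let D : ℕ → Set (ℕ → ∀ k, S k) := fun N ↦
    {x | ε ≤ prodEst x N φ - c ∧ ∀ j ∈ Finset.Ioc N L, prodEst x j φ - c < ε}
  have hms : ∀ N, Measurable (fun x : ℕ → ∀ k, S k ↦ prodEst x N φ - c) :=
    fun N ↦ (measurable_prodEst N hφ).sub_const c
  have hint : ∀ N, Integrable (fun x : ℕ → ∀ k, S k ↦ prodEst x N φ - c) Q :=
    fun N ↦ (integrable_prodEst μ N hi).sub (integrable_const c)
  have hDm : ∀ N, MeasurableSet (D N) := by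
    intro N
    refine (measurableSet_le measurable_const (hms N)).inter ?_
    have : {x : ℕ → ∀ k, S k | ∀ j ∈ Finset.Ioc N L, prodEst x j φ - c < ε} =
        ⋂ j ∈ Finset.Ioc N L, {x | prodEst x j φ - c < ε} := by
      ext x; simp
    change MeasurableSet {x : ℕ → ∀ k, S k | ∀ j ∈ Finset.Ioc N L, prodEst x j φ - c < ε}
    rw [this]
    exact Finset.measurableSet_biInter _ fun j _ ↦ measurableSet_lt (hms j) measurable_const
  have hdisj : ∀ N ∈ Finset.Icc M L, ∀ N' ∈ Finset.Icc M L, N < N' → Disjoint (D N) (D N') := by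
    intro N hN N' hN' hlt
    rw [Set.disjoint_left]
    rintro x ⟨_, h⟩ ⟨h', _⟩
    exact absurd (h N' (Finset.mem_Ioc.2 ⟨hlt, (Finset.mem_Icc.1 hN').2⟩)) (not_lt.2 h')
  have hpair : (Finset.Icc M L : Set ℕ).Pairwise (Function.onFun Disjoint D) := by
    intro N hN N' hN' hne
    rcases lt_or_gt_of_ne hne with h | h
    · exact hdisj N hN N' hN' h
    · exact (hdisj N' hN' N hN h).symm
  have hunion : {x | ∃ N ∈ Finset.Icc M L, ε ≤ prodEst x N φ - c} = ⋃ N ∈ Finset.Icc M L, D N := by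
    ext x
    simp only [Set.mem_ofPred_eq, Set.mem_iUnion, exists_prop]
    constructor
    · intro h
      classical
      let F := (Finset.Icc M L).filter fun N ↦ ε ≤ prodEst x N φ - c
      have hF : F.Nonempty := by
        obtain ⟨N, h1, h2⟩ := h
        exact ⟨N, Finset.mem_filter.2 ⟨h1, h2⟩⟩
      have hmax := Finset.mem_filter.1 (F.max'_mem hF)
      refine ⟨F.max' hF, hmax.1, hmax.2, fun j hj ↦ ?_⟩
      by_contra hcon
      have hj' := Finset.mem_Ioc.1 hj
      have : j ∈ F := Finset.mem_filter.2 ⟨Finset.mem_Icc.2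
        ⟨(Finset.mem_Icc.1 hmax.1).1.trans hj'.1.le, hj'.2⟩, not_lt.1 hcon⟩
      exact absurd (F.le_max' j this) (not_le.2 hj'.1)
    · rintro ⟨N, h1, h2⟩
      exact ⟨N, h1, h2.1⟩
  have hsymm : ∀ N, ∀ m : Fin K → ℕ, (∀ k, m k < N) →
      permute (fun k ↦ Equiv.swap 0 (m k)) ⁻¹' D N = D N := by
    intro N m hm
    ext x
    simp only [D, Set.mem_preimage, Set.mem_ofPred_eq, prodEst_permute_swap m hm]
    refine and_congr_right fun _ ↦ forall₂_congr fun j hj ↦ ?_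
    rw [prodEst_permute_swap m fun k ↦ (hm k).trans (Finset.mem_Ioc.1 hj).1]
  have hD : ∀ N ∈ Finset.Icc M L,
      ε * Q.real (D N) ≤ ∫ x in D N, (prodEst x M φ - c) ∂Q := by
    intro N hN
    have hMN := (Finset.mem_Icc.1 hN).1
    -- The reverse martingale property: as M ≤ N, the event is symmetric enough for both estimators
    -- to have the mean of `φ (x 0)` on it.
    have e : ∫ x in D N, (prodEst x M φ - c) ∂Q = ∫ x in D N, (prodEst x N φ - c) ∂Q := by
      rw [integral_sub (integrable_prodEst μ M hi).integrableOn (integrable_const c),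
        integral_sub (integrable_prodEst μ N hi).integrableOn (integrable_const c),
        setIntegral_prodEst μ hM hφ hi (hDm N) fun m hm ↦
          hsymm N m fun k ↦ (hm k).trans_le hMN,
        setIntegral_prodEst μ (by omega) hφ hi (hDm N) (hsymm N)]
    rw [e]
    refine setIntegral_ge_of_const_le_real (hDm N) (measure_ne_top _ _) (fun x hx ↦ hx.1)
      (hint N).integrableOn
  rw [hunion, measureReal_biUnion_finset hpair fun N _ ↦ hDm N, Finset.mul_sum]
  calc ∑ N ∈ Finset.Icc M L, ε * Q.real (D N)
      ≤ ∑ N ∈ Finset.Icc M L, ∫ x in D N, (prodEst x M φ - c) ∂Q := Finset.sum_le_sum hD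
    _ = ∫ x in ⋃ N ∈ Finset.Icc M L, D N, (prodEst x M φ - c) ∂Q :=
      (integral_biUnion_finset _ (fun N _ ↦ hDm N) hpair fun N _ ↦ (hint M).integrableOn).symm
    _ ≤ ∫ x in ⋃ N ∈ Finset.Icc M L, D N, |prodEst x M φ - c| ∂Q :=
      integral_mono (hint M).integrableOn (hint M).abs.integrableOn fun x ↦ le_abs_self _
    _ ≤ ∫ x, |prodEst x M φ - c| ∂Q :=
      setIntegral_le_integral (hint M).abs (Eventually.of_forall fun x ↦ abs_nonneg _)

/-- The one-sided inequality is applied to `φ` and `-φ`, whence the factor 2. Its bound does not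
depend on L, so L → ∞ by continuity from below. -/
lemma mul_measure_exists_le_abs {M : ℕ} (hM : M ≠ 0) {φ : (∀ k, S k) → ℝ}
    (hφ : Measurable φ) (hi : Integrable φ (Measure.pi μ)) (c : ℝ) {ε : ℝ} (hε : 0 ≤ ε) :
    ε * (sampleLaw μ).real {x | ∃ N ≥ M, ε ≤ |prodEst x N φ - c|} ≤
      2 * ∫ x, |prodEst x M φ - c| ∂(sampleLaw μ) := by
  let E : ℕ → Set (ℕ → ∀ k, S k) := fun L ↦ {x | ∃ N ∈ Finset.Icc M L, ε ≤ |prodEst x N φ - c|}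
  have hE : {x | ∃ N ≥ M, ε ≤ |prodEst x N φ - c|} = ⋃ L, E L := by
    ext x
    simp only [E, Set.mem_ofPred_eq, Set.mem_iUnion, Finset.mem_Icc]
    constructor
    · rintro ⟨N, h1, h2⟩; exact ⟨N, N, ⟨h1, le_rfl⟩, h2⟩
    · rintro ⟨L, N, h1, h2⟩; exact ⟨N, h1.1, h2⟩
  have hmono : Monotone E := by
    rintro L L' hL x ⟨N, h1, h2⟩
    exact ⟨N, Finset.Icc_subset_Icc_right hL h1, h2⟩
  have hlim : Tendsto (fun L ↦ ε * (sampleLaw μ).real (E L)) atTop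
      (𝓝 (ε * (sampleLaw μ).real (⋃ L, E L))) :=
    ((ENNReal.tendsto_toReal (measure_ne_top _ _)).comp
      (tendsto_measure_iUnion_atTop hmono)).const_mul ε
  rw [hE]
  refine le_of_tendsto' hlim fun L ↦ ?_
  have h1 := mul_measure_exists_le μ hM L hφ hi c ε
  have h2 := mul_measure_exists_le μ hM L hφ.neg hi.neg (-c) ε
  have hneg : ∀ (x : ℕ → ∀ k, S k) N, prodEst x N (-φ) = -prodEst x N φ := by
    intro x N
    simpa [Pi.neg_def] using prodEst_const_mul x N (-1) φ
  simp only [hneg] at h2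
  have h3 : ∀ x N, |-prodEst (S := S) x N φ - -c| = |prodEst x N φ - c| := by
    intro x N; rw [← abs_neg]; congr 1; ring
  simp only [h3] at h2
  have hsub : E L ⊆ {x | ∃ N ∈ Finset.Icc M L, ε ≤ prodEst x N φ - c} ∪
      {x | ∃ N ∈ Finset.Icc M L, ε ≤ -prodEst x N φ - -c} := by
    rintro x ⟨N, hN, h⟩
    rcases le_abs'.1 h with h | h
    · exact Or.inr ⟨N, hN, by linarith⟩
    · exact Or.inl ⟨N, hN, h⟩
  have h4 := mul_le_mul_of_nonneg_left
    ((measureReal_mono (μ := sampleLaw μ) hsub).trans (measureReal_union_le _ _)) hε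
  linarith

/-- Convergence in mean of the product-form estimator implies almost sure convergence. -/
lemma ae_tendsto_prodEst_of_tendsto_integral {φ : (∀ k, S k) → ℝ}
    (hφ : Measurable φ) (hi : Integrable φ (Measure.pi μ)) (c : ℝ)
    (h : Tendsto (fun M ↦ ∫ x, |prodEst x M φ - c| ∂(sampleLaw μ)) atTop (𝓝 0)) :
    ∀ᵐ x ∂(sampleLaw μ), Tendsto (fun N ↦ prodEst x N φ) atTop (𝓝 c) := by
  have key : ∀ m : ℕ, ∀ᵐ x ∂(sampleLaw μ), ∃ M, ∀ N ≥ M,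
      |prodEst x N φ - c| < 1 / ((m : ℝ) + 1) := by
    intro m
    have hε : (0 : ℝ) < 1 / ((m : ℝ) + 1) := by positivity
    rw [ae_iff]
    set B : Set (ℕ → ∀ k, S k) := {x | ¬ ∃ M, ∀ N ≥ M, |prodEst x N φ - c| < 1 / ((m : ℝ) + 1)}
    -- `B` lies in the exceedance event of every M, while the bounds tend to 0.
    have hb : ∀ᶠ M : ℕ in atTop, 1 / ((m : ℝ) + 1) * (sampleLaw μ).real B ≤
        2 * ∫ x, |prodEst x M φ - c| ∂(sampleLaw μ) := by
      filter_upwards [eventually_ne_atTop 0] with M hM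
      refine le_trans ?_ (mul_measure_exists_le_abs μ hM hφ hi c hε.le)
      refine mul_le_mul_of_nonneg_left (measureReal_mono ?_) hε.le
      intro x hx
      simp only [B, Set.mem_ofPred_eq, not_exists, not_forall, not_lt] at hx
      obtain ⟨N, hN, h⟩ := hx M
      exact ⟨N, hN, h⟩
    have h0 : 1 / ((m : ℝ) + 1) * (sampleLaw μ).real B ≤ 2 * 0 := ge_of_tendsto (h.const_mul 2) hb
    have h1 : (sampleLaw μ).real B = 0 := by
      refine le_antisymm ?_ measureReal_nonneg
      by_contra hcon
      have := mul_pos hε (not_le.1 hcon)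
      linarith
    exact (measureReal_eq_zero_iff).1 h1
  filter_upwards [ae_all_iff.2 key] with x hx
  rw [Metric.tendsto_atTop]
  intro ε hε
  obtain ⟨m, hm⟩ := exists_nat_one_div_lt hε
  obtain ⟨M, hM⟩ := hx m
  exact ⟨M, fun N hN ↦ (hM N hN).trans hm⟩

end StrongLaw

/-! ### Second moments, convergence in mean and the strong law -/

section SecondMoment

variable {K : ℕ} {S : Fin K → Type*} [∀ k, MeasurableSpace (S k)]
  (μ : ∀ k, Measure (S k)) [∀ k, IsProbabilityMeasure (μ k)]

lemma integral_prodEst {N : ℕ} (hN : N ≠ 0) {φ : (∀ k, S k) → ℝ} (hφ : Measurable φ)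
    (hi : Integrable φ (Measure.pi μ)) :
    ∫ x, prodEst x N φ ∂(sampleLaw μ) = ∫ y, φ y ∂(Measure.pi μ) := by
  have h := setIntegral_prodEst μ hN hφ hi MeasurableSet.univ fun _ _ ↦ rfl
  simp only [Measure.restrict_univ] at h
  rw [h, ← (measurePreserving_sample μ 0).map_eq,
    integral_map (measurable_pi_apply 0).aemeasurable hφ.aestronglyMeasurable]

lemma integral_pick_mul_pick {r : (∀ k, S k) → ℝ} (hr : Measurable r) (n n' : Fin K → ℕ) :
    ∫ x, r (pick n x) * r (pick n' x) ∂(sampleLaw μ) =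
      ∫ p, r p.1 * r (mix {k | n k = n' k} p) ∂((Measure.pi μ).prod (Measure.pi μ)) := by
  have hF : Measurable (fun q : (∀ k, S k) × (∀ k, S k) ↦ r q.1 * r q.2) := by fun_prop
  have h := congrArg (fun ν ↦ ∫ q, r q.1 * r q.2 ∂ν) (measurePreserving_pick_pair μ n n')
  beta_reduce at h
  rwa [integral_map (by fun_prop) hF.aestronglyMeasurable,
    integral_map (by fun_prop) hF.aestronglyMeasurable] at h

/-- By 2ab ≤ a² + b², since `p.1` and `mix A p` both have law `Measure.pi μ`. -/
lemma integral_mul_mix_le {r : (∀ k, S k) → ℝ} (hr2 : MemLp r 2 (Measure.pi μ))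
    (A : Finset (Fin K)) :
    ∫ p, r p.1 * r (mix A p) ∂((Measure.pi μ).prod (Measure.pi μ)) ≤
      ∫ y, r y ^ 2 ∂(Measure.pi μ) := by
  have hs := hr2.integrable_sq
  have h1 : MeasurePreserving Prod.fst ((Measure.pi μ).prod (Measure.pi μ)) (Measure.pi μ) :=
    measurePreserving_fst
  have h2 := measurePreserving_mix μ A
  have i1 : Integrable (fun p : (∀ k, S k) × (∀ k, S k) ↦ r p.1 ^ 2)
      ((Measure.pi μ).prod (Measure.pi μ)) := h1.integrable_comp_of_integrable hs
  have i2 : Integrable (fun p : (∀ k, S k) × (∀ k, S k) ↦ r (mix A p) ^ 2)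
      ((Measure.pi μ).prod (Measure.pi μ)) := h2.integrable_comp_of_integrable hs
  have i3 : Integrable (fun p : (∀ k, S k) × (∀ k, S k) ↦ r p.1 * r (mix A p))
      ((Measure.pi μ).prod (Measure.pi μ)) :=
    (hr2.comp_measurePreserving h1).integrable_mul (hr2.comp_measurePreserving h2)
  have e1 : ∫ p, r p.1 ^ 2 ∂((Measure.pi μ).prod (Measure.pi μ)) = ∫ y, r y ^ 2 ∂(Measure.pi μ) := by
    conv_rhs => rw [← h1.map_eq]
    rw [integral_map (by fun_prop) (by rw [h1.map_eq]; exact hs.aestronglyMeasurable)]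
  have e2 : ∫ p, r (mix A p) ^ 2 ∂((Measure.pi μ).prod (Measure.pi μ)) =
      ∫ y, r y ^ 2 ∂(Measure.pi μ) := by
    conv_rhs => rw [← h2.map_eq]
    rw [integral_map (by fun_prop) (by rw [h2.map_eq]; exact hs.aestronglyMeasurable)]
  calc ∫ p, r p.1 * r (mix A p) ∂((Measure.pi μ).prod (Measure.pi μ))
      ≤ ∫ p, (1 / 2 * r p.1 ^ 2 + 1 / 2 * r (mix A p) ^ 2) ∂((Measure.pi μ).prod (Measure.pi μ)) :=
        integral_mono i3 ((i1.const_mul _).add (i2.const_mul _)) fun p ↦ by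
          have := sq_nonneg (r p.1 - r (mix A p))
          simp only
          linarith
    _ = ∫ y, r y ^ 2 ∂(Measure.pi μ) := by
        rw [integral_add (i1.const_mul _) (i2.const_mul _), integral_const_mul,
          integral_const_mul, e1, e2]
        ring

lemma card_agree {N : ℕ} (A : Finset (Fin K)) (n : Fin K → Fin N) :
    (Finset.univ.filter fun n' : Fin K → Fin N ↦ ∀ k ∈ A, n k = n' k).card =
      N ^ (K - A.card) := by
  have h : (Finset.univ.filter fun n' : Fin K → Fin N ↦ ∀ k ∈ A, n k = n' k) =
      Fintype.piFinset fun k ↦ if k ∈ A then {n k} else Finset.univ := by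
    ext n'
    simp only [Finset.mem_filter, Finset.mem_univ, true_and, Fintype.mem_piFinset]
    refine forall_congr' fun k ↦ ?_
    by_cases hk : k ∈ A <;> simp [hk, eq_comm]
  rw [h, Fintype.card_piFinset]
  have : ∀ k, (if k ∈ A then {n k} else (Finset.univ : Finset (Fin N))).card =
      if k ∈ A then 1 else N := by
    intro k; by_cases hk : k ∈ A <;> simp [hk]
  simp only [this]
  rw [Finset.prod_ite, Finset.prod_const_one, one_mul, Finset.prod_const]
  congr 1
  have hc : (Finset.univ.filter fun k ↦ k ∉ A) = Aᶜ := by ext; simp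
  rw [hc, Finset.card_compl, Fintype.card_fin]

/-- If evaluations of `r` that share fewer than `a` coordinates are uncorrelated, then the second
moment of the product-form estimator of `r` is of order `N ^ (-a)`. -/
lemma integral_prodEst_sq_le {r : (∀ k, S k) → ℝ} (hr : Measurable r)
    (hr2 : MemLp r 2 (Measure.pi μ)) {a : ℕ} (ha : a ≤ K)
    (horth : ∀ A : Finset (Fin K), A.card < a →
      ∫ p, r p.1 * r (mix A p) ∂((Measure.pi μ).prod (Measure.pi μ)) = 0)
    {N : ℕ} (hN : N ≠ 0) :
    ∫ x, prodEst x N r ^ 2 ∂(sampleLaw μ) ≤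
      (K.choose a : ℝ) * (∫ y, r y ^ 2 ∂(Measure.pi μ)) * ((N : ℝ) ^ a)⁻¹ := by
  set V := ∫ y, r y ^ 2 ∂(Measure.pi μ)
  have hV : 0 ≤ V := integral_nonneg fun _ ↦ sq_nonneg _
  have hi : ∀ n n' : Fin K → ℕ,
      Integrable (fun x ↦ r (pick n x) * r (pick n' x)) (sampleLaw μ) := fun n n' ↦
    (hr2.comp_measurePreserving (measurePreserving_pick μ n)).integrable_mul
      (hr2.comp_measurePreserving (measurePreserving_pick μ n'))
  have hexp : ∀ x, prodEst x N r ^ 2 = (((N : ℝ) ^ K)⁻¹) ^ 2 *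
      ∑ n : Fin K → Fin N, ∑ n' : Fin K → Fin N,
        r (pick (fun k ↦ n k) x) * r (pick (fun k ↦ n' k) x) := by
    intro x
    rw [prodEst_eq_sum_pick, mul_pow]
    congr 1
    rw [sq, Finset.sum_mul_sum]
  simp_rw [hexp]
  rw [integral_const_mul, integral_finsetSum _ fun n _ ↦ integrable_finsetSum _ fun n' _ ↦ hi _ _]
  -- A union bound: a correlated pair agrees on some set of exactly a coordinates. Each such set
  -- accounts for N^K · N^(K-a) of the N^(2K) pairs, which yields the factor N^(-a).
  have hterm : ∀ n n' : Fin K → Fin N,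
      ∫ x, r (pick (fun k ↦ n k) x) * r (pick (fun k ↦ n' k) x) ∂(sampleLaw μ) ≤
        ∑ A ∈ Finset.univ.powersetCard a, if ∀ k ∈ A, n k = n' k then V else 0 := by
    intro n n'
    rw [integral_pick_mul_pick μ hr]
    have hnn : ∀ A ∈ (Finset.univ : Finset (Fin K)).powersetCard a,
        0 ≤ if ∀ k ∈ A, n k = n' k then V else 0 := fun A _ ↦ by split_ifs <;> simp [hV]
    by_cases hc : (Finset.univ.filter fun k : Fin K ↦ (n k : ℕ) = n' k).card < a
    · rw [horth _ hc]
      exact Finset.sum_nonneg hnn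
    · obtain ⟨A, hA, hAc⟩ := Finset.exists_subset_card_eq (not_lt.1 hc)
      have hA' : A ∈ (Finset.univ : Finset (Fin K)).powersetCard a := by simp [hAc]
      refine (integral_mul_mix_le μ hr2 _).trans ?_
      refine le_trans ?_ (Finset.single_le_sum hnn hA')
      rw [if_pos]
      intro k hk
      have := hA hk
      simpa [Fin.ext_iff] using this
  have hsum : ∀ n : Fin K → Fin N,
      ∫ x, ∑ n' : Fin K → Fin N, r (pick (fun k ↦ n k) x) * r (pick (fun k ↦ n' k) x)
        ∂(sampleLaw μ) ≤ (K.choose a : ℝ) * ((N : ℝ) ^ (K - a) * V) := by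
    intro n
    rw [integral_finsetSum _ fun n' _ ↦ hi _ _]
    refine (Finset.sum_le_sum fun n' _ ↦ hterm n n').trans ?_
    rw [Finset.sum_comm]
    have : ∀ A ∈ (Finset.univ : Finset (Fin K)).powersetCard a,
        (∑ n' : Fin K → Fin N, if ∀ k ∈ A, n k = n' k then V else 0) = (N : ℝ) ^ (K - a) * V := by
      intro A hA
      rw [← Finset.sum_filter, Finset.sum_const, card_agree, (Finset.mem_powersetCard.1 hA).2,
        nsmul_eq_mul]
      push_cast
      rfl
    rw [Finset.sum_congr rfl this, Finset.sum_const, Finset.card_powersetCard, Finset.card_univ,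
      Fintype.card_fin, nsmul_eq_mul]
  have hN' : (N : ℝ) ≠ 0 := by exact_mod_cast hN
  calc _ ≤ (((N : ℝ) ^ K)⁻¹) ^ 2 *
        ∑ _n : Fin K → Fin N, (K.choose a : ℝ) * ((N : ℝ) ^ (K - a) * V) := by
        gcongr with n
        exact hsum n
    _ = _ := by
        rw [Finset.sum_const, Finset.card_univ, Fintype.card_fun, Fintype.card_fin,
          Fintype.card_fin, nsmul_eq_mul, pow_sub₀ _ hN' ha]
        push_cast
        field_simp

lemma sq_integral_abs_le {α : Type*} [MeasurableSpace α] {ν : Measure α} [IsProbabilityMeasure ν]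
    {f : α → ℝ} (hf : MemLp f 2 ν) : (∫ x, |f x| ∂ν) ^ 2 ≤ ∫ x, f x ^ 2 ∂ν := by
  have h := variance_nonneg |f| ν
  rw [variance_eq_sub hf.abs] at h
  simp only [Pi.pow_apply, Pi.abs_apply, sq_abs] at h
  linarith

lemma memLp_prodEst (N : ℕ) {r : (∀ k, S k) → ℝ} (hr2 : MemLp r 2 (Measure.pi μ)) :
    MemLp (fun x ↦ prodEst x N r) 2 (sampleLaw μ) := by
  simp_rw [prodEst_eq_sum_pick]
  exact (memLp_finsetSum _ fun n _ ↦
    hr2.comp_measurePreserving (measurePreserving_pick μ _)).const_mul _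

/-- After centring, tuples that share no coordinate are independent, hence uncorrelated. The
second-moment bound with a = 1 makes the variance O(1/M). -/
lemma tendsto_integral_abs_prodEst_of_memLp_two (hK : 1 ≤ K) {φ : (∀ k, S k) → ℝ}
    (hφ : Measurable φ) (h2 : MemLp φ 2 (Measure.pi μ)) :
    Tendsto (fun M ↦ ∫ x, |prodEst x M φ - ∫ y, φ y ∂(Measure.pi μ)| ∂(sampleLaw μ))
      atTop (𝓝 0) := by
  set c := ∫ y, φ y ∂(Measure.pi μ) with hc
  have hr : Measurable (fun y ↦ φ y + -c) := by fun_prop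
  have hr2 : MemLp (fun y ↦ φ y + -c) 2 (Measure.pi μ) := h2.add (memLp_const _)
  have h0 : ∫ y, (φ y + -c) ∂(Measure.pi μ) = 0 := by
    rw [integral_add (h2.integrable one_le_two) (integrable_const _)]
    simp [hc]
  have horth : ∀ A : Finset (Fin K), A.card < 1 →
      ∫ p, (φ p.1 + -c) * (φ (mix A p) + -c) ∂((Measure.pi μ).prod (Measure.pi μ)) = 0 := by
    intro A hA
    obtain rfl : A = ∅ := by simpa using hA
    simp only [mix_empty]
    rw [integral_prod_mul (fun y ↦ φ y + -c) (fun y ↦ φ y + -c), h0, zero_mul]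
  have hlim : Tendsto (fun M : ℕ ↦ √((K.choose 1 : ℝ) * (∫ y, (φ y + -c) ^ 2 ∂(Measure.pi μ)) *
      ((M : ℝ) ^ 1)⁻¹)) atTop (𝓝 0) := by
    rw [← Real.sqrt_zero]
    refine (Real.continuous_sqrt.tendsto _).comp ?_
    simp only [pow_one]
    simpa using (tendsto_inv_atTop_nhds_zero_nat (𝕜 := ℝ)).const_mul
      ((K.choose 1 : ℝ) * ∫ y, (φ y + -c) ^ 2 ∂(Measure.pi μ))
  refine squeeze_zero' (Eventually.of_forall fun M ↦ integral_nonneg fun _ ↦ abs_nonneg _) ?_ hlim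
  filter_upwards [eventually_ne_atTop 0] with M hM
  have he : ∀ x, prodEst x M φ - c = prodEst x M (fun y ↦ φ y + -c) := by
    intro x; rw [prodEst_add x M φ fun _ ↦ -c, prodEst_const x hM]; ring
  simp_rw [he]
  refine Real.le_sqrt_of_sq_le ?_
  exact (sq_integral_abs_le (memLp_prodEst μ M hr2)).trans
    (integral_prodEst_sq_le μ hr hr2 hK horth hM)

/-- The triangle inequality and unbiasedness for `|φ|`. Uniformity in N is what lets simple
functions approximate `φ`. -/
lemma integral_abs_prodEst_le {N : ℕ} (hN : N ≠ 0) {φ : (∀ k, S k) → ℝ} (hφ : Measurable φ)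
    (hi : Integrable φ (Measure.pi μ)) :
    ∫ x, |prodEst x N φ| ∂(sampleLaw μ) ≤ ∫ y, |φ y| ∂(Measure.pi μ) := by
  rw [← integral_prodEst μ hN hφ.abs hi.abs]
  exact integral_mono (integrable_prodEst μ N hi).abs (integrable_prodEst μ N hi.abs)
    fun x ↦ abs_prodEst_le x N φ

lemma tendsto_integral_abs_prodEst (hK : 1 ≤ K) {φ : (∀ k, S k) → ℝ}
    (hφ : Measurable φ) (hi : Integrable φ (Measure.pi μ)) :
    Tendsto (fun M ↦ ∫ x, |prodEst x M φ - ∫ y, φ y ∂(Measure.pi μ)| ∂(sampleLaw μ))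
      atTop (𝓝 0) := by
  refine tendsto_order.2 ⟨fun b hb ↦ Eventually.of_forall fun M ↦
    hb.trans_le (integral_nonneg fun _ ↦ abs_nonneg _), fun ε hε ↦ ?_⟩
  -- The three thirds of ε pay for the estimator of `φ - f`, the error of the estimator of `f`, and
  -- the difference of the means.
  obtain ⟨f, hf, -⟩ := (memLp_one_iff_integrable.2 hi).exists_simpleFunc_eLpNorm_sub_lt
    ENNReal.one_ne_top (ε := ENNReal.ofReal (ε / 3)) (by simpa using hε)
  have hf2 : MemLp f 2 (Measure.pi μ) := f.memLp_of_isFiniteMeasure 2 _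
  have hfi : Integrable f (Measure.pi μ) := hf2.integrable one_le_two
  have hdi : Integrable (fun y ↦ φ y - f y) (Measure.pi μ) := hi.sub hfi
  have hd : ∫ y, |φ y - f y| ∂(Measure.pi μ) < ε / 3 := by
    have h1 : ENNReal.ofReal (∫ y, |φ y - f y| ∂(Measure.pi μ)) < ENNReal.ofReal (ε / 3) := by
      rw [ofReal_integral_eq_lintegral_ofReal hdi.abs
        (Eventually.of_forall fun _ ↦ abs_nonneg _)]
      rw [eLpNorm_one_eq_lintegral_enorm] at hf
      convert hf using 2
      ext y
      rw [Pi.sub_apply, Real.enorm_eq_ofReal_abs]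
    exact (ENNReal.ofReal_lt_ofReal_iff (by positivity)).1 h1
  have hm : |(∫ y, f y ∂(Measure.pi μ)) - ∫ y, φ y ∂(Measure.pi μ)| < ε / 3 := by
    rw [abs_sub_comm, ← integral_sub hi hfi]
    exact (abs_integral_le_integral_abs).trans_lt hd
  filter_upwards [eventually_ne_atTop 0,
    (tendsto_order.1 (tendsto_integral_abs_prodEst_of_memLp_two μ hK f.measurable hf2)).2
      (ε / 3) (by positivity)] with M hM hfM
  set c := ∫ y, φ y ∂(Measure.pi μ)
  set d := ∫ y, f y ∂(Measure.pi μ)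
  have hpt : ∀ x, |prodEst x M φ - c| ≤
      |prodEst x M (fun y ↦ φ y - f y)| + |prodEst x M f - d| + |d - c| := by
    intro x
    have h1 := prodEst_add x M (fun y ↦ φ y - f y) f
    simp only [sub_add_cancel] at h1
    have h2 : prodEst x M φ - c =
        prodEst x M (fun y ↦ φ y - f y) + (prodEst x M f - d) + (d - c) := by
      linarith [show prodEst x M (fun y ↦ φ y) = prodEst x M φ from rfl]
    rw [h2]
    exact abs_add_three _ _ _
  have i1 : Integrable (fun x ↦ |prodEst x M (fun y ↦ φ y - f y)|) (sampleLaw μ) :=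
    (integrable_prodEst μ M hdi).abs
  have i2 : Integrable (fun x ↦ |prodEst x M f - d|) (sampleLaw μ) :=
    ((integrable_prodEst μ M hfi).sub (integrable_const d)).abs
  have h3 := integral_mono ((integrable_prodEst μ M hi).sub (integrable_const c)).abs
    ((i1.add i2).add (integrable_const |d - c|)) hpt
  have h4 : ∫ x, ((fun x ↦ |prodEst x M (fun y ↦ φ y - f y)|) + fun x ↦ |prodEst x M f - d|) x +
      |d - c| ∂(sampleLaw μ) = (∫ x, |prodEst x M (fun y ↦ φ y - f y)| ∂(sampleLaw μ)) +
      (∫ x, |prodEst x M f - d| ∂(sampleLaw μ)) + |d - c| := by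
    rw [integral_add (i1.add i2) (integrable_const _), integral_add' i1 i2]
    simp
  have h5 := integral_abs_prodEst_le μ hM (hφ.sub f.measurable) hdi
  refine lt_of_le_of_lt (h3.trans h4.le) ?_
  simp only [Pi.sub_apply] at h5
  linarith [show ∫ x, |prodEst x M (φ - ⇑f)| ∂(sampleLaw μ) =
    ∫ x, |prodEst x M (fun y ↦ φ y - f y)| ∂(sampleLaw μ) from rfl]

/-- The strong law of large numbers for the product-form estimator. -/
theorem ae_tendsto_prodEst (hK : 1 ≤ K) {φ : (∀ k, S k) → ℝ}
    (hφ : Measurable φ) (hi : Integrable φ (Measure.pi μ)) :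
    ∀ᵐ x ∂(sampleLaw μ), Tendsto (fun N ↦ prodEst x N φ) atTop
      (𝓝 (∫ y, φ y ∂(Measure.pi μ))) :=
  ae_tendsto_prodEst_of_tendsto_integral μ hφ hi _ (tendsto_integral_abs_prodEst μ hK hφ hi)

end SecondMoment

/-! ### Projection onto additive functions -/

section Projection

variable {K : ℕ} {S : Fin K → Type*}

/-- Distributivity for a product of sums in which every factor but the k-th sums the constant 1. -/
lemma sum_apply_eq_pow_mul {N : ℕ} (k : Fin K) (f : Fin N → ℝ) :
    ∑ n : Fin K → Fin N, f (n k) = (N : ℝ) ^ (K - 1) * ∑ j, f j := by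
  have h := Finset.prod_univ_sum (fun _ : Fin K ↦ (Finset.univ : Finset (Fin N)))
    fun i j ↦ if i = k then f j else (1 : ℝ)
  rw [Fintype.piFinset_univ] at h
  have h1 : ∀ n : Fin K → Fin N, ∏ i, (if i = k then f (n i) else 1) = f (n k) := by
    intro n; rw [Finset.prod_ite_eq' Finset.univ k]; simp
  have h2 : ∀ i : Fin K, (∑ j, if i = k then f j else (1 : ℝ)) =
      if i = k then ∑ j, f j else (N : ℝ) := by
    intro i; split_ifs <;> simp
  simp only [h1, h2] at h
  rw [← h, ← Finset.mul_prod_erase _ _ (Finset.mem_univ k), if_pos rfl, mul_comm]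
  congr 1
  rw [Finset.prod_congr rfl fun i hi ↦ if_neg (Finset.ne_of_mem_erase hi), Finset.prod_const,
    Finset.card_erase_of_mem (Finset.mem_univ k), Finset.card_univ, Fintype.card_fin]

lemma prodEst_sum_eval {N : ℕ} (x : ℕ → ∀ k, S k) (f : ∀ k, S k → ℝ) :
    prodEst x N (fun y ↦ ∑ k, f k (y k)) = stdEst x N (fun y ↦ ∑ k, f k (y k)) := by
  unfold prodEst stdEst
  rw [Finset.sum_comm, Finset.sum_comm (s := (Finset.univ : Finset (Fin N))),
    Finset.mul_sum, Finset.mul_sum]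
  refine Finset.sum_congr rfl fun k _ ↦ ?_
  rw [sum_apply_eq_pow_mul k fun j : Fin N ↦ f k (x j k)]
  rcases eq_or_ne N 0 with rfl | hN
  · simp
  have hN' : (N : ℝ) ≠ 0 := by exact_mod_cast hN
  rw [pow_sub₀ _ hN' (show 1 ≤ K from k.pos), pow_one]
  field_simp

variable [∀ k, MeasurableSpace (S k)]
  (μ : ∀ k, Measure (S k)) [∀ k, IsProbabilityMeasure (μ k)]

lemma integrable_update_comp {φ : (∀ k, S k) → ℝ} (hi : Integrable φ (Measure.pi μ)) (k : Fin K) :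
    Integrable (fun p : S k × (∀ k, S k) ↦ φ (Function.update p.2 k p.1))
      ((μ k).prod (Measure.pi μ)) :=
  (measurePreserving_update μ k).integrable_comp_of_integrable hi

lemma integral_update_comp {φ : (∀ k, S k) → ℝ} (hφ : Measurable φ) (k : Fin K) :
    ∫ p, φ (Function.update p.2 k p.1) ∂((μ k).prod (Measure.pi μ)) =
      ∫ y, φ y ∂(Measure.pi μ) := by
  rw [← (measurePreserving_update μ k).map_eq,
    integral_map (measurePreserving_update μ k).measurable.aemeasurable hφ.aestronglyMeasurable,
    (measurePreserving_update μ k).map_eq]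

lemma measurable_marginalMean {φ : (∀ k, S k) → ℝ} (hφ : Measurable φ) (k : Fin K) :
    Measurable (marginalMean μ φ k) := by
  have h : Measurable (fun p : S k × (∀ k, S k) ↦ φ (Function.update p.2 k p.1)) :=
    hφ.comp (measurePreserving_update μ k).measurable
  exact (h.stronglyMeasurable.integral_prod_right (ν := Measure.pi μ)).measurable

/-- Cauchy–Schwarz in the integrated-out variables bounds the squared marginal mean by the marginal
mean of `φ ^ 2`, which Fubini makes integrable. -/
lemma memLp_marginalMean {φ : (∀ k, S k) → ℝ} (hφ : Measurable φ)
    (h2 : MemLp φ 2 (Measure.pi μ)) (k : Fin K) : MemLp (marginalMean μ φ k) 2 (μ k) := by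
  rw [memLp_two_iff_integrable_sq (measurable_marginalMean μ hφ k).aestronglyMeasurable]
  have hs := integrable_update_comp μ h2.integrable_sq k
  have hm : Measurable (fun p : S k × (∀ k, S k) ↦ φ (Function.update p.2 k p.1)) :=
    hφ.comp (measurePreserving_update μ k).measurable
  refine hs.integral_prod_left.mono'
    ((measurable_marginalMean μ hφ k).pow_const 2).aestronglyMeasurable ?_
  filter_upwards [hs.prod_right_ae] with a ha
  have hma : Measurable fun y : ∀ k, S k ↦ φ (Function.update y k a) :=
    hm.comp measurable_prodMk_left
  rw [Real.norm_of_nonneg (sq_nonneg _)]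
  refine le_trans ?_ (sq_integral_abs_le
    ((memLp_two_iff_integrable_sq hma.aestronglyMeasurable).2 ha))
  rw [← sq_abs (marginalMean μ φ k a)]
  exact pow_le_pow_left₀ (abs_nonneg _) abs_integral_le_integral_abs 2

lemma integral_marginalMean {φ : (∀ k, S k) → ℝ} (hφ : Measurable φ)
    (hi : Integrable φ (Measure.pi μ)) (k : Fin K) :
    ∫ a, marginalMean μ φ k a ∂(μ k) = ∫ y, φ y ∂(Measure.pi μ) := by
  rw [← integral_update_comp μ hφ k, integral_prod _ (integrable_update_comp μ hi k)]
  rfl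

/-- The sum of the one-coordinate marginal means of `φ`. -/
noncomputable def firstOrder (φ : (∀ k, S k) → ℝ) (y : ∀ k, S k) : ℝ :=
  ∑ k, marginalMean μ φ k (y k)

lemma measurable_firstOrder {φ : (∀ k, S k) → ℝ} (hφ : Measurable φ) :
    Measurable (firstOrder μ φ) :=
  Finset.measurable_sum _ fun k _ ↦ (measurable_marginalMean μ hφ k).comp (measurable_pi_apply k)

lemma memLp_marginalMean_eval {φ : (∀ k, S k) → ℝ} (hφ : Measurable φ)
    (h2 : MemLp φ 2 (Measure.pi μ)) (k : Fin K) :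
    MemLp (fun y : ∀ k, S k ↦ marginalMean μ φ k (y k)) 2 (Measure.pi μ) :=
  (memLp_marginalMean μ hφ h2 k).comp_measurePreserving (measurePreserving_eval μ k)

lemma memLp_firstOrder {φ : (∀ k, S k) → ℝ} (hφ : Measurable φ)
    (h2 : MemLp φ 2 (Measure.pi μ)) : MemLp (firstOrder μ φ) 2 (Measure.pi μ) :=
  memLp_finsetSum _ fun k _ ↦ memLp_marginalMean_eval μ hφ h2 k

lemma integral_marginalMean_eval {φ : (∀ k, S k) → ℝ} (hφ : Measurable φ)
    (hi : Integrable φ (Measure.pi μ)) (k : Fin K) :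
    ∫ y, marginalMean μ φ k (y k) ∂(Measure.pi μ) = ∫ y, φ y ∂(Measure.pi μ) := by
  rw [← integral_marginalMean μ hφ hi k, ← (measurePreserving_eval μ k).map_eq,
    integral_map (measurable_pi_apply k).aemeasurable
      (measurable_marginalMean μ hφ k).aestronglyMeasurable]

lemma integral_firstOrder {φ : (∀ k, S k) → ℝ} (hφ : Measurable φ)
    (h2 : MemLp φ 2 (Measure.pi μ)) (h0 : ∫ y, φ y ∂(Measure.pi μ) = 0) :
    ∫ y, firstOrder μ φ y ∂(Measure.pi μ) = 0 := by
  unfold firstOrder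
  rw [integral_finsetSum _ fun k _ ↦ (memLp_marginalMean_eval μ hφ h2 k).integrable one_le_two]
  simp [integral_marginalMean_eval μ hφ (h2.integrable one_le_two), h0]

/-- The summands depend on distinct, independent coordinates, so their variances add. -/
lemma integral_sq_firstOrder {φ : (∀ k, S k) → ℝ} (hφ : Measurable φ)
    (h2 : MemLp φ 2 (Measure.pi μ)) (h0 : ∫ y, φ y ∂(Measure.pi μ) = 0) :
    ∫ y, firstOrder μ φ y ^ 2 ∂(Measure.pi μ) = prodVar μ φ := by
  have h := variance_sum_pi (μ := μ) (X := fun k ↦ marginalMean μ φ k)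
    (memLp_marginalMean μ hφ h2)
  have e : (∑ k, fun y : ∀ k, S k ↦ marginalMean μ φ k (y k)) = firstOrder μ φ := by
    ext y; simp [firstOrder]
  rw [e, variance_eq_integral (measurable_firstOrder μ hφ).aemeasurable,
    integral_firstOrder μ hφ h2 h0] at h
  simp only [sub_zero] at h
  rw [h, prodVar]
  refine Finset.sum_congr rfl fun k _ ↦ ?_
  rw [variance_eq_integral (measurable_marginalMean μ hφ k).aemeasurable,
    integral_marginalMean μ hφ (h2.integrable one_le_two)]

/-- Subtracting the first-order terms leaves a function whose one-coordinate marginal means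
vanish. -/
lemma marginalMean_sub_firstOrder {φ : (∀ k, S k) → ℝ} (hφ : Measurable φ)
    (h2 : MemLp φ 2 (Measure.pi μ)) (h0 : ∫ y, φ y ∂(Measure.pi μ) = 0) (k : Fin K) :
    ∀ᵐ a ∂(μ k), marginalMean μ (fun y ↦ φ y - firstOrder μ φ y) k a = 0 := by
  have hi := h2.integrable one_le_two
  filter_upwards [(integrable_update_comp μ hi k).prod_right_ae] with a ha
  have hj : ∀ j, Integrable (fun y : ∀ k, S k ↦ marginalMean μ φ j (Function.update y k a j))
      (Measure.pi μ) ∧ ∫ y, marginalMean μ φ j (Function.update y k a j) ∂(Measure.pi μ) =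
        if j = k then marginalMean μ φ k a else 0 := by
    intro j
    -- The term j = k is constant once the k-th entry is fixed at `a`; any other term does not see
    -- `a` and averages to the mean of `φ`, which is 0.
    by_cases hjk : j = k
    · subst hjk; simp
    · simp only [Function.update_of_ne hjk, if_neg hjk]
      exact ⟨(memLp_marginalMean_eval μ hφ h2 j).integrable one_le_two,
        (integral_marginalMean_eval μ hφ hi j).trans h0⟩
  have hs : ∫ y, firstOrder μ φ (Function.update y k a) ∂(Measure.pi μ) = marginalMean μ φ k a := by
    unfold firstOrder
    rw [integral_finsetSum _ fun j _ ↦ (hj j).1]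
    simp [fun j ↦ (hj j).2]
  have hsi : Integrable (fun y ↦ firstOrder μ φ (Function.update y k a)) (Measure.pi μ) :=
    integrable_finsetSum _ fun j _ ↦ (hj j).1
  unfold marginalMean
  rw [integral_sub ha hsi, hs]
  exact sub_self _

lemma integral_mul_eval_eq_zero {r : (∀ k, S k) → ℝ} (hr : Measurable r)
    {k : Fin K} (hk : ∀ᵐ a ∂(μ k), marginalMean μ r k a = 0) {f : S k → ℝ} (hf : Measurable f)
    (hi : Integrable (fun y ↦ r y * f (y k)) (Measure.pi μ)) :
    ∫ y, r y * f (y k) ∂(Measure.pi μ) = 0 := by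
  have hm : Measurable (fun y : ∀ k, S k ↦ r y * f (y k)) :=
    hr.mul (hf.comp (measurable_pi_apply k))
  rw [← integral_update_comp μ hm k, integral_prod _ (integrable_update_comp μ hi k)]
  simp only [Function.update_self, integral_mul_const]
  rw [← integral_zero (S k) ℝ (μ := μ k)]
  refine integral_congr_ae ?_
  filter_upwards [hk] with a ha
  change marginalMean μ r k a * f a = 0
  rw [ha, zero_mul]

/-- Given the first copy, integrating out the second turns the second factor into the marginal mean
of `r` at the shared entry, which vanishes. -/
lemma integral_mul_mix_singleton_eq_zero {r : (∀ k, S k) → ℝ}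
    (h2 : MemLp r 2 (Measure.pi μ)) {k : Fin K} (hk : ∀ᵐ a ∂(μ k), marginalMean μ r k a = 0) :
    ∫ p, r p.1 * r (mix {k} p) ∂((Measure.pi μ).prod (Measure.pi μ)) = 0 := by
  have h1 : MeasurePreserving Prod.fst ((Measure.pi μ).prod (Measure.pi μ)) (Measure.pi μ) :=
    measurePreserving_fst
  have hi : Integrable (fun p : (∀ k, S k) × (∀ k, S k) ↦ r p.1 * r (mix {k} p))
      ((Measure.pi μ).prod (Measure.pi μ)) :=
    (h2.comp_measurePreserving h1).integrable_mul
      (h2.comp_measurePreserving (measurePreserving_mix μ {k}))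
  rw [integral_prod _ hi]
  simp only [mix_singleton, integral_const_mul]
  rw [← integral_zero (∀ k, S k) ℝ (μ := Measure.pi μ)]
  refine integral_congr_ae ?_
  filter_upwards [(measurePreserving_eval μ k).quasiMeasurePreserving.ae hk] with y hy
  change r y * marginalMean μ r k (y k) = 0
  rw [show marginalMean μ r k (y k) = 0 from hy, mul_zero]

/-- Pythagoras: the remainder `r` is orthogonal to every function of a single coordinate occurring
in `firstOrder μ φ`, and the gap between the variances is its squared norm. -/
lemma prodVar_le_stdVar {φ : (∀ k, S k) → ℝ} (hφ : Measurable φ)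
    (h2 : MemLp φ 2 (Measure.pi μ)) (h0 : ∫ y, φ y ∂(Measure.pi μ) = 0) :
    prodVar μ φ ≤ stdVar μ φ := by
  set r : (∀ k, S k) → ℝ := fun y ↦ φ y - firstOrder μ φ y with hrdef
  have hr : Measurable r := hφ.sub (measurable_firstOrder μ hφ)
  have hr2 : MemLp r 2 (Measure.pi μ) := h2.sub (memLp_firstOrder μ hφ h2)
  have hmul : ∀ k, Integrable (fun y ↦ r y * marginalMean μ φ k (y k)) (Measure.pi μ) := fun k ↦
    hr2.integrable_mul (memLp_marginalMean_eval μ hφ h2 k)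
  have hz : ∫ y, r y * firstOrder μ φ y ∂(Measure.pi μ) = 0 := by
    simp only [firstOrder, Finset.mul_sum]
    rw [integral_finsetSum _ fun k _ ↦ hmul k]
    exact Finset.sum_eq_zero fun k _ ↦ integral_mul_eval_eq_zero μ hr
      (marginalMean_sub_firstOrder μ hφ h2 h0 k) (measurable_marginalMean μ hφ k) (hmul k)
  have hrs : Integrable (fun y ↦ r y * firstOrder μ φ y) (Measure.pi μ) :=
    hr2.integrable_mul (memLp_firstOrder μ hφ h2)
  have e : ∀ y, φ y ^ 2 = r y ^ 2 + 2 * (r y * firstOrder μ φ y) + firstOrder μ φ y ^ 2 := by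
    intro y; simp only [hrdef]; ring
  have hi12 : Integrable (fun y ↦ r y ^ 2 + 2 * (r y * firstOrder μ φ y)) (Measure.pi μ) :=
    hr2.integrable_sq.add (hrs.const_mul 2)
  rw [stdVar, h0]
  simp only [sub_zero]
  simp_rw [e]
  rw [integral_add hi12 (memLp_firstOrder μ hφ h2).integrable_sq,
    integral_add hr2.integrable_sq (hrs.const_mul 2), integral_const_mul, hz,
    integral_sq_firstOrder μ hφ h2 h0]
  have : 0 ≤ ∫ y, r y ^ 2 ∂(Measure.pi μ) := integral_nonneg fun _ ↦ sq_nonneg _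
  linarith

/-- The product-form estimator of a centred function differs from the standard estimator of its
first-order part by a term of second moment `O(N⁻²)`. -/
lemma exists_integral_prodEst_sub_stdEst_sq_le (hK : 2 ≤ K) {φ : (∀ k, S k) → ℝ}
    (hφ : Measurable φ) (h2 : MemLp φ 2 (Measure.pi μ)) (h0 : ∫ y, φ y ∂(Measure.pi μ) = 0) :
    ∃ C : ℝ, ∀ N : ℕ, N ≠ 0 →
      ∫ x, (prodEst x N φ - stdEst x N (firstOrder μ φ)) ^ 2 ∂(sampleLaw μ) ≤
        C * ((N : ℝ) ^ 2)⁻¹ := by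
  set r : (∀ k, S k) → ℝ := fun y ↦ φ y + -1 * firstOrder μ φ y with hrdef
  have hrsub : r = fun y ↦ φ y - firstOrder μ φ y := by ext y; simp [hrdef, sub_eq_add_neg]
  have hr : Measurable r := hφ.add ((measurable_firstOrder μ hφ).const_mul _)
  have hr2 : MemLp r 2 (Measure.pi μ) := h2.add ((memLp_firstOrder μ hφ h2).const_mul _)
  have hr0 : ∫ y, r y ∂(Measure.pi μ) = 0 := by
    rw [hrsub, integral_sub (h2.integrable one_le_two)
      ((memLp_firstOrder μ hφ h2).integrable one_le_two), h0, integral_firstOrder μ hφ h2 h0,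
      sub_zero]
  refine ⟨K.choose 2 * ∫ y, r y ^ 2 ∂(Measure.pi μ), fun N hN ↦ ?_⟩
  have he : ∀ x, prodEst x N φ - stdEst x N (firstOrder μ φ) = prodEst x N r := by
    intro x
    rw [hrdef, prodEst_add, prodEst_const_mul]
    unfold firstOrder
    rw [prodEst_sum_eval]
    ring
  simp_rw [he]
  -- Here a = 2: no shared coordinate is handled by centring, one shared coordinate by the vanishing
  -- marginal means.
  refine integral_prodEst_sq_le μ hr hr2 hK (fun A hA ↦ ?_) hN
  rcases Nat.lt_succ_iff_lt_or_eq.1 hA with hA | hA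
  · obtain rfl : A = ∅ := by simpa using hA
    simp only [mix_empty]
    rw [integral_prod_mul r r, hr0, zero_mul]
  · obtain ⟨k, rfl⟩ := Finset.card_eq_one.1 hA
    refine integral_mul_mix_singleton_eq_zero μ hr2 ?_
    rw [hrsub]
    exact marginalMean_sub_firstOrder μ hφ h2 h0 k

end Projection

/-! ### Slutsky's theorem and the central limit theorems -/

section Limits

/-- Asymptotic normality of a self-normalized estimator `R`, given the asymptotic normality of the
centred numerator `A` and the consistency of the denominator `B`. -/
lemma tendstoInDistribution_selfNormalized {Ω Ω' : Type*} [MeasurableSpace Ω] [MeasurableSpace Ω']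
    {Q : Measure Ω} [IsProbabilityMeasure Q] {P : Measure Ω'} [IsProbabilityMeasure P]
    {A B R : ℕ → Ω → ℝ} {Z : Ω' → ℝ} {b m : ℝ} (hb : b ≠ 0)
    (hA : TendstoInDistribution (fun (N : ℕ) x ↦ √(N : ℝ) * A N x) atTop Z (fun _ ↦ Q) P)
    (hBm : ∀ N, Measurable (B N)) (hRm : ∀ N, Measurable (R N))
    (hB : ∀ᵐ x ∂Q, Tendsto (fun N ↦ B N x) atTop (𝓝 b))
    (hR : ∀ N x, B N x ≠ 0 → R N x - m = A N x * (b / B N x)) :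
    TendstoInDistribution (fun (N : ℕ) x ↦ √(N : ℝ) * (R N x - m)) atTop Z (fun _ ↦ Q) P := by
  have hYm : ∀ N, Measurable fun x ↦ b / B N x := fun N ↦ measurable_const.div (hBm N)
  have hY : TendstoInMeasure Q (fun N x ↦ b / B N x) atTop fun _ ↦ (1 : ℝ) := by
    refine tendstoInMeasure_of_tendsto_ae (fun N ↦ (hYm N).aestronglyMeasurable) ?_
    filter_upwards [hB] with x hx
    have h := (tendsto_const_nhds (x := b)).div hx hb
    rwa [div_self hb] at h
  have h1 := hA.continuous_comp_prodMk_of_tendstoInMeasure_const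
    (g := fun p : ℝ × ℝ ↦ p.1 * p.2) (by fun_prop) hY fun N ↦ (hYm N).aemeasurable
  simp only [mul_one] at h1
  -- `hR` may fail where the denominator vanishes, but almost surely that stops happening for large
  -- N, so the discrepancy tends to 0 in measure.
  refine tendstoInDistribution_of_tendstoInMeasure_sub _ _ h1 ?_ fun N ↦
    (((hRm N).sub_const m).const_mul _).aemeasurable
  refine tendstoInMeasure_of_tendsto_ae (fun N ↦ AEMeasurable.aestronglyMeasurable
    ((((hRm N).sub_const m).const_mul _).aemeasurable.sub (h1.forall_aemeasurable N))) ?_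
  filter_upwards [hB] with x hx
  refine tendsto_const_nhds.congr' ?_
  filter_upwards [hx.eventually_ne hb] with N hN
  simp only [Pi.sub_apply, Pi.zero_apply, hR N x hN]
  ring

/-- Convergence in distribution only depends on the joint law of the underlying variables. -/
lemma tendstoInDistribution_comp_of_map_eq {Ω Ω' Ω'' : Type*} [MeasurableSpace Ω]
    [MeasurableSpace Ω'] [MeasurableSpace Ω''] {Q : Measure Ω} [IsProbabilityMeasure Q]
    {P : Measure Ω'} [IsProbabilityMeasure P] {P' : Measure Ω''} [IsProbabilityMeasure P']
    {T : Ω' → Ω} (hT : AEMeasurable T P) (hPQ : P.map T = Q) {F : ℕ → Ω → ℝ} {Z : Ω'' → ℝ}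
    (hF : TendstoInDistribution F atTop Z (fun _ ↦ Q) P') :
    TendstoInDistribution (fun N ω ↦ F N (T ω)) atTop Z (fun _ ↦ P) P' := by
  subst hPQ
  refine ⟨fun N ↦ (hF.forall_aemeasurable N).comp_aemeasurable hT, hF.aemeasurable_limit, ?_⟩
  refine hF.tendsto.congr fun N ↦ Subtype.ext ?_
  exact (AEMeasurable.map_map_of_aemeasurable (hF.forall_aemeasurable N) hT)

variable {K : ℕ} {S : Fin K → Type*}

lemma stdEst_eq_sum_range (x : ℕ → ∀ k, S k) (N : ℕ) (φ : (∀ k, S k) → ℝ) :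
    stdEst x N φ = (N : ℝ)⁻¹ * ∑ n ∈ Finset.range N, φ (x n) := by
  rw [stdEst, Fin.sum_univ_eq_sum_range fun n ↦ φ (x n)]

lemma stdEst_add (x : ℕ → ∀ k, S k) (N : ℕ) (φ ψ : (∀ k, S k) → ℝ) :
    stdEst x N (fun y ↦ φ y + ψ y) = stdEst x N φ + stdEst x N ψ := by
  simp [stdEst, Finset.sum_add_distrib, mul_add]

lemma stdEst_const_mul (x : ℕ → ∀ k, S k) (N : ℕ) (c : ℝ) (φ : (∀ k, S k) → ℝ) :
    stdEst x N (fun y ↦ c * φ y) = c * stdEst x N φ := by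
  simp only [stdEst, ← Finset.mul_sum]; ring

lemma sqrt_mul_inv_natCast (N : ℕ) : √(N : ℝ) * (N : ℝ)⁻¹ = (√(N : ℝ))⁻¹ := by
  rw [← div_eq_mul_inv, Real.sqrt_div_self', one_div]

variable [∀ k, MeasurableSpace (S k)]

lemma measurable_stdEst (N : ℕ) {φ : (∀ k, S k) → ℝ} (hφ : Measurable φ) :
    Measurable (fun x ↦ stdEst x N φ) := by
  unfold stdEst; fun_prop

variable (μ : ∀ k, Measure (S k)) [∀ k, IsProbabilityMeasure (μ k)]

lemma identDistrib_sample {φ : (∀ k, S k) → ℝ} (hφ : Measurable φ) (n : ℕ) :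
    IdentDistrib (fun x : ℕ → ∀ k, S k ↦ φ (x n)) (fun x ↦ φ (x 0)) (sampleLaw μ)
      (sampleLaw μ) :=
  IdentDistrib.comp (u := φ) ⟨(measurable_pi_apply n).aemeasurable,
    (measurable_pi_apply 0).aemeasurable, (measurePreserving_sample μ n).map_eq.trans
      (measurePreserving_sample μ 0).map_eq.symm⟩ hφ

lemma integral_sample {φ : (∀ k, S k) → ℝ} (hφ : Measurable φ) :
    ∫ x, φ (x 0) ∂(sampleLaw μ) = ∫ y, φ y ∂(Measure.pi μ) := by
  rw [← (measurePreserving_sample μ 0).map_eq,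
    integral_map (measurable_pi_apply 0).aemeasurable hφ.aestronglyMeasurable]

lemma ae_tendsto_stdEst {φ : (∀ k, S k) → ℝ}
    (hφ : Measurable φ) (hi : Integrable φ (Measure.pi μ)) :
    ∀ᵐ x ∂(sampleLaw μ), Tendsto (fun N ↦ stdEst x N φ) atTop
      (𝓝 (∫ y, φ y ∂(Measure.pi μ))) := by
  have h := strong_law_ae (μ := sampleLaw μ) (fun n x ↦ φ (x n))
    ((measurePreserving_sample μ 0).integrable_comp_of_integrable hi)
    (fun i j hij ↦ ((iIndepFun_sample μ).indepFun hij).comp hφ hφ) (identDistrib_sample μ hφ)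
  simp only [smul_eq_mul, integral_sample μ hφ] at h
  simpa only [stdEst_eq_sum_range] using h

/-- The central limit theorem for the standard estimator of a centred function. -/
lemma tendstoInDistribution_stdEst {φ : (∀ k, S k) → ℝ} (hφ : Measurable φ)
    (h2 : MemLp φ 2 (Measure.pi μ)) (h0 : ∫ y, φ y ∂(Measure.pi μ) = 0) :
    TendstoInDistribution (fun (N : ℕ) x ↦ √(N : ℝ) * stdEst x N φ) atTop id
      (fun _ ↦ sampleLaw μ) (gaussianReal 0 (∫ y, φ y ^ 2 ∂(Measure.pi μ)).toNNReal) := by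
  have hφ0 : Measurable fun x : ℕ → ∀ k, S k ↦ φ (x 0) := hφ.comp (measurable_pi_apply 0)
  have hv : Var[fun x ↦ φ (x 0); sampleLaw μ] = ∫ y, φ y ^ 2 ∂(Measure.pi μ) := by
    rw [variance_eq_integral hφ0.aemeasurable, integral_sample μ hφ, h0]
    simp only [sub_zero]
    exact integral_sample μ (hφ.pow_const 2)
  have h := tendstoInDistribution_inv_sqrt_mul_sum_sub (P := sampleLaw μ)
    (X := fun n x ↦ φ (x n)) (Y := id)
    (P' := gaussianReal 0 (∫ y, φ y ^ 2 ∂(Measure.pi μ)).toNNReal)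
    (by rw [hv]; exact HasLaw.id)
    (h2.comp_measurePreserving (measurePreserving_sample μ 0))
    ((iIndepFun_sample μ).comp (fun _ ↦ φ) fun _ ↦ hφ) (identDistrib_sample μ hφ)
  simp only [integral_sample μ hφ, h0, mul_zero, sub_zero] at h
  convert h using 3 with N x
  rw [stdEst_eq_sum_range, ← mul_assoc, sqrt_mul_inv_natCast]

/-- The central limit theorem for the product-form estimator of a centred function. -/
lemma tendstoInDistribution_prodEst (hK : 2 ≤ K) {φ : (∀ k, S k) → ℝ} (hφ : Measurable φ)
    (h2 : MemLp φ 2 (Measure.pi μ)) (h0 : ∫ y, φ y ∂(Measure.pi μ) = 0) :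
    TendstoInDistribution (fun (N : ℕ) x ↦ √(N : ℝ) * prodEst x N φ) atTop id
      (fun _ ↦ sampleLaw μ) (gaussianReal 0 (prodVar μ φ).toNNReal) := by
  have h1 := tendstoInDistribution_stdEst μ (measurable_firstOrder μ hφ)
    (memLp_firstOrder μ hφ h2) (integral_firstOrder μ hφ h2 h0)
  rw [integral_sq_firstOrder μ hφ h2 h0] at h1
  have hmp : ∀ N : ℕ, Measurable fun x : ℕ → ∀ k, S k ↦ √(N : ℝ) * prodEst x N φ :=
    fun N ↦ (measurable_prodEst N hφ).const_mul _
  refine tendstoInDistribution_of_tendstoInMeasure_sub _ _ h1 ?_ fun N ↦ (hmp N).aemeasurable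
  obtain ⟨C, hC⟩ := exists_integral_prodEst_sub_stdEst_sq_le μ hK hφ h2 h0
  have hd : ∀ N : ℕ, MemLp (fun x ↦ √(N : ℝ) * (prodEst x N φ - stdEst x N (firstOrder μ φ))) 2
      (sampleLaw μ) := by
    intro N
    refine ((memLp_prodEst μ N h2).sub ?_).const_mul _
    unfold firstOrder
    simp_rw [← prodEst_sum_eval]
    exact memLp_prodEst μ N (memLp_firstOrder μ hφ h2)
  have hlim : Tendsto (fun N : ℕ ↦ ∫ x, |√(N : ℝ) *
      (prodEst x N φ - stdEst x N (firstOrder μ φ))| ∂(sampleLaw μ)) atTop (𝓝 0) := by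
    -- The factor √N squares to N, which reduces the second moment bound C / N² to C / N.
    have hs : Tendsto (fun N : ℕ ↦ √(C * (N : ℝ)⁻¹)) atTop (𝓝 0) := by
      rw [← Real.sqrt_zero]
      refine (Real.continuous_sqrt.tendsto _).comp ?_
      simpa using (tendsto_inv_atTop_nhds_zero_nat (𝕜 := ℝ)).const_mul C
    refine squeeze_zero' (Eventually.of_forall fun M ↦ integral_nonneg fun _ ↦ abs_nonneg _) ?_ hs
    filter_upwards [eventually_ne_atTop 0] with N hN
    refine Real.le_sqrt_of_sq_le ((sq_integral_abs_le (hd N)).trans ?_)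
    simp only [mul_pow, Real.sq_sqrt (Nat.cast_nonneg N)]
    rw [integral_const_mul]
    have hN' : (N : ℝ) ≠ 0 := by exact_mod_cast hN
    calc (N : ℝ) * _ ≤ N * (C * ((N : ℝ) ^ 2)⁻¹) := by gcongr; exact hC N hN
      _ = C * (N : ℝ)⁻¹ := by field_simp
  refine tendstoInMeasure_of_tendsto_eLpNorm (p := 1) one_ne_zero
    (fun N ↦ ?_) aestronglyMeasurable_zero ?_
  · exact ((hmp N).sub ((measurable_stdEst N
      (measurable_firstOrder μ hφ)).const_mul _)).aestronglyMeasurable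
  · have hE := ENNReal.tendsto_ofReal hlim
    rw [ENNReal.ofReal_zero] at hE
    refine hE.congr fun N ↦ ?_
    rw [sub_zero, eLpNorm_one_eq_lintegral_enorm, ofReal_integral_eq_lintegral_ofReal
      ((hd N).integrable one_le_two).abs (Eventually.of_forall fun _ ↦ abs_nonneg _)]
    refine lintegral_congr fun x ↦ ?_
    rw [Real.enorm_eq_ofReal_abs, mul_sub]
    rfl

end Limits

/-! ### The weight and the centred weighted integrand -/

section SelfNormalized

variable {K : ℕ} {S : Fin K → Type*} [∀ k, MeasurableSpace (S k)]
  (μ : ∀ k, Measure (S k)) {γ : Measure (∀ k, S k)} {w φ : (∀ k, S k) → ℝ}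

lemma measurable_centredWeighted (hw : Measurable w) (hφ : Measurable φ) :
    Measurable (centredWeighted γ w φ) := by
  unfold centredWeighted; fun_prop

/-- By linearity of the estimators, dividing by the estimator of `w` turns this splitting into an
exact formula for the self-normalized error. The factor `w y * 1` matches the denominator. -/
lemma mul_eq_centredWeighted (hb : γ.real Set.univ ≠ 0) (y : ∀ k, S k) :
    w y * φ y = γ.real Set.univ * centredWeighted γ w φ y +
      (∫ z, φ z ∂(normalized γ)) * (w y * 1) := by
  unfold centredWeighted
  field_simp
  ring

variable [IsFiniteMeasure γ]

lemma integrable_weight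
    (hwγ : w =ᵐ[Measure.pi μ] fun y ↦ (γ.rnDeriv (Measure.pi μ) y).toReal) :
    Integrable w (Measure.pi μ) :=
  Measure.integrable_toReal_rnDeriv.congr hwγ.symm

variable [∀ k, IsProbabilityMeasure (μ k)]

lemma integral_normalized (hγμ : γ ≪ Measure.pi μ)
    (hwγ : w =ᵐ[Measure.pi μ] fun y ↦ (γ.rnDeriv (Measure.pi μ) y).toReal) :
    ∫ z, φ z ∂(normalized γ) = (∫ y, w y * φ y ∂(Measure.pi μ)) / γ.real Set.univ := by
  rw [normalized, integral_smul_measure, ← integral_rnDeriv_smul hγμ, ENNReal.toReal_inv,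
    smul_eq_mul, ← measureReal_def, inv_mul_eq_div]
  congr 1
  refine integral_congr_ae ?_
  filter_upwards [hwγ] with y hy
  rw [hy, smul_eq_mul]

lemma integral_weight (hγμ : γ ≪ Measure.pi μ)
    (hwγ : w =ᵐ[Measure.pi μ] fun y ↦ (γ.rnDeriv (Measure.pi μ) y).toReal) :
    ∫ y, w y ∂(Measure.pi μ) = γ.real Set.univ := by
  rw [integral_congr_ae hwγ, Measure.integral_toReal_rnDeriv hγμ]

lemma integral_centredWeighted (hb : γ.real Set.univ ≠ 0) (hγμ : γ ≪ Measure.pi μ)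
    (hwγ : w =ᵐ[Measure.pi μ] fun y ↦ (γ.rnDeriv (Measure.pi μ) y).toReal)
    (hi : Integrable (fun y ↦ w y * φ y) (Measure.pi μ)) :
    ∫ y, centredWeighted γ w φ y ∂(Measure.pi μ) = 0 := by
  have hwi := integrable_weight μ hwγ
  have e : ∀ y, centredWeighted γ w φ y = (γ.real Set.univ)⁻¹ *
      (w y * φ y - (∫ z, φ z ∂(normalized γ)) * w y) := by
    intro y; unfold centredWeighted; ring
  simp_rw [e]
  rw [integral_const_mul, integral_sub hi (hwi.const_mul _), integral_const_mul,
    integral_weight μ hγμ hwγ, integral_normalized μ hγμ hwγ]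
  field_simp
  ring

end SelfNormalized

end ProductFormIS

/-! ### The main theorem -/

theorem mainTheorem8 {K : ℕ} (hK : 1 < K) {S : Fin K → Type*} [∀ k, MeasurableSpace (S k)]
    (μ : ∀ k, Measure (S k)) [∀ k, IsProbabilityMeasure (μ k)]
    (γ : Measure (∀ k, S k)) [IsFiniteMeasure γ] (hγ : γ ≠ 0) (hγμ : γ ≪ Measure.pi μ)
    (w : (∀ k, S k) → ℝ) (hw : Measurable w)
    (hwγ : w =ᵐ[Measure.pi μ] fun y ↦ (γ.rnDeriv (Measure.pi μ) y).toReal)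
    {Ω : Type*} [MeasurableSpace Ω] (P : Measure Ω) [IsProbabilityMeasure P]
    (X : ℕ → Ω → ∀ k, S k) (hX : ∀ n, HasLaw (X n) (Measure.pi μ) P) (hXi : iIndepFun X P)
    (φ : (∀ k, S k) → ℝ) (hφ : Measurable φ)
    (hwφ : MemLp (fun y ↦ w y * φ y) 2 (Measure.pi μ)) :
    (∀ᵐ ω ∂P, Tendsto (fun N : ℕ ↦ ProductFormIS.prodSnisEst w (fun n ↦ X n ω) N φ) atTop
        (𝓝 (∫ z, φ z ∂(ProductFormIS.normalized γ)))) ∧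
    (MemLp (ProductFormIS.centredWeighted γ w φ) 2 (Measure.pi μ) →
      TendstoInDistribution
        (fun (N : ℕ) ω ↦ √(N : ℝ) * (ProductFormIS.prodSnisEst w (fun n ↦ X n ω) N φ -
          ∫ z, φ z ∂(ProductFormIS.normalized γ)))
        atTop id (fun _ ↦ P)
        (gaussianReal 0
          (ProductFormIS.prodVar μ (ProductFormIS.centredWeighted γ w φ)).toNNReal) ∧
      TendstoInDistribution
        (fun (N : ℕ) ω ↦ √(N : ℝ) * (ProductFormIS.snisEst w (fun n ↦ X n ω) N φ -
          ∫ z, φ z ∂(ProductFormIS.normalized γ)))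
        atTop id (fun _ ↦ P)
        (gaussianReal 0
          (ProductFormIS.stdVar μ (ProductFormIS.centredWeighted γ w φ)).toNNReal) ∧
      ProductFormIS.prodVar μ (ProductFormIS.centredWeighted γ w φ) ≤
        ProductFormIS.stdVar μ (ProductFormIS.centredWeighted γ w φ)) := by
  have hK1 : 1 ≤ K := hK.le
  set b := γ.real Set.univ with hbdef
  have hb : b ≠ 0 := by
    rw [hbdef, Ne, measureReal_eq_zero_iff, Measure.measure_univ_eq_zero]
    exact hγ
  set m := ∫ z, φ z ∂(ProductFormIS.normalized γ) with hmdef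
  set g := ProductFormIS.centredWeighted γ w φ
  have hi : Integrable (fun y ↦ w y * φ y) (Measure.pi μ) := hwφ.integrable one_le_two
  have hwi : Integrable w (Measure.pi μ) := ProductFormIS.integrable_weight μ hwγ
  have hwm : Measurable fun y ↦ w y * φ y := hw.mul hφ
  have hw1 : (fun y ↦ w y * 1) = w := by ext y; exact mul_one _
  have hw1m : Measurable fun y ↦ w y * 1 := by rwa [hw1]
  have hg : Measurable g := ProductFormIS.measurable_centredWeighted hw hφ
  have hg0 : ∫ y, g y ∂(Measure.pi μ) = 0 :=
    ProductFormIS.integral_centredWeighted μ hb hγμ hwγ hi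
  have hdec : (fun y ↦ w y * φ y) = fun y ↦ b * g y + m * (w y * 1) :=
    funext (ProductFormIS.mul_eq_centredWeighted hb)
  have hXm : AEMeasurable (fun ω n ↦ X n ω) P := aemeasurable_pi_iff.2 fun n ↦ (hX n).aemeasurable
  -- All claims depend only on the law of the whole sequence, so they can be proved on the canonical
  -- sample space.
  have hlaw : P.map (fun ω n ↦ X n ω) = ProductFormIS.sampleLaw μ :=
    (hXi.hasLaw_infinitePi hX hXm).map_eq
  have hBprod : ∀ᵐ x ∂(ProductFormIS.sampleLaw μ),
      Tendsto (fun N ↦ ProductFormIS.prodISEst w x N fun _ ↦ 1) atTop (𝓝 b) := by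
    have h := ProductFormIS.ae_tendsto_prodEst μ hK1 hw hwi
    rw [ProductFormIS.integral_weight μ hγμ hwγ] at h
    simpa only [ProductFormIS.prodISEst, hw1] using h
  have hBstd : ∀ᵐ x ∂(ProductFormIS.sampleLaw μ),
      Tendsto (fun N ↦ ProductFormIS.isEst w x N fun _ ↦ 1) atTop (𝓝 b) := by
    have h := ProductFormIS.ae_tendsto_stdEst μ hw hwi
    rw [ProductFormIS.integral_weight μ hγμ hwγ] at h
    simpa only [ProductFormIS.isEst, hw1] using h
  refine ⟨?_, fun hg2 ↦ ⟨?_, ?_, ProductFormIS.prodVar_le_stdVar μ hg hg2 hg0⟩⟩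
  · suffices h : ∀ᵐ x ∂(P.map fun ω n ↦ X n ω),
        Tendsto (fun N ↦ ProductFormIS.prodSnisEst w x N φ) atTop (𝓝 m) from ae_of_ae_map hXm h
    rw [hlaw]
    filter_upwards [hBprod, ProductFormIS.ae_tendsto_prodEst μ hK1 hwm hi] with x h1 h2
    rw [hmdef, ProductFormIS.integral_normalized μ hγμ hwγ]
    exact h2.div h1 hb
  · refine ProductFormIS.tendstoInDistribution_comp_of_map_eq hXm hlaw
      (F := fun N x ↦ √(N : ℝ) * (ProductFormIS.prodSnisEst w x N φ - m)) ?_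
    refine ProductFormIS.tendstoInDistribution_selfNormalized hb
      (ProductFormIS.tendstoInDistribution_prodEst μ hK hg hg2 hg0)
      (fun N ↦ ProductFormIS.measurable_prodEst N hw1m)
      (fun N ↦ (ProductFormIS.measurable_prodEst N hwm).div
        (ProductFormIS.measurable_prodEst N hw1m)) hBprod fun N x hN ↦ ?_
    unfold ProductFormIS.prodSnisEst
    unfold ProductFormIS.prodISEst at hN ⊢
    rw [hdec, ProductFormIS.prodEst_add x N (fun y ↦ b * g y), ProductFormIS.prodEst_const_mul,
      ProductFormIS.prodEst_const_mul]
    rw [add_div, mul_div_cancel_right₀ _ hN, add_sub_cancel_right]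
    ring
  · have hvar : ProductFormIS.stdVar μ g = ∫ y, g y ^ 2 ∂(Measure.pi μ) := by
      simp [ProductFormIS.stdVar, hg0]
    rw [hvar]
    refine ProductFormIS.tendstoInDistribution_comp_of_map_eq hXm hlaw
      (F := fun N x ↦ √(N : ℝ) * (ProductFormIS.snisEst w x N φ - m)) ?_
    refine ProductFormIS.tendstoInDistribution_selfNormalized hb
      (ProductFormIS.tendstoInDistribution_stdEst μ hg hg2 hg0)
      (fun N ↦ ProductFormIS.measurable_stdEst N hw1m)
      (fun N ↦ (ProductFormIS.measurable_stdEst N hwm).div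
        (ProductFormIS.measurable_stdEst N hw1m)) hBstd fun N x hN ↦ ?_
    unfold ProductFormIS.snisEst
    unfold ProductFormIS.isEst at hN ⊢
    rw [hdec, ProductFormIS.stdEst_add x N (fun y ↦ b * g y), ProductFormIS.stdEst_const_mul,
      ProductFormIS.stdEst_const_mul]
    rw [add_div, mul_div_cancel_right₀ _ hN, add_sub_cancel_right]
    ring
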